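/- All graphs are finite and simple. For a graph $G$ let $D(G)$ be the diagonal matrix of its vertex degrees, let $A(G)$ be its adjacency matrix, and for $\alpha\in[0,1]$ put $A_\alpha(G)=\alpha D(G)+(1-\alpha)A(G)$. The largest eigenvalue of this real symmetric matrix is called the $A_\alpha$-index of $G$. The independence number of $G$ is the largest size of a set of pairwise non-adjacent vertices. For integers $s,t,k\ge 0$ let $H_3(s,t,k)$ be the tree on $s+t+k+5$ vertices obtained from a path $v_1w_1v_2w_2v_3$ on five vertices by attaching $s$ pendant edges at $v_1$, $t$ pendant edges at $v_2$ and $k$ pendant edges at $v_3$. Theorem. Let $n\ge 9$ and $\alpha\in[0,1)$, and let $G$ be a graph that has the minimum $A_\alpha$-index among all connected graphs on $n$ vertices with independence number $n-3$. Then $G\cong H_3(s,t,k)$ for some integers $s,t,k\ge 0$ with $|s-k|\le 1$ and $s+t+k=n-5$. Furthermore: (i) if $\alpha\in[\tfrac12,1)$ and $n=3m$, then $G\cong H_3(m-1,m-3,m-1)$; (ii) if $\alpha\in[\tfrac12,1)$ and $n=3m+1$, then $G\cong H_3(m-1,m-2,m-1)$; (iii) if $\alpha\in[\tfrac{11}{20},1)$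 and $n=3m+2$, then $G\cong H_3(m,m-3,m)$. -/

import Mathlib

namespace AAlpha

/-- The matrix `A_α(G) = α D(G) + (1 - α) A(G)`, where `D(G)` is the diagonal matrix of vertex
degrees and `A(G)` the adjacency matrix of the finite simple graph `G`. -/
noncomputable def matrix {V : Type*} [Fintype V] [DecidableEq V] (α : ℝ) (G : SimpleGraph V) :
    Matrix V V ℝ :=
  letI : DecidableRel G.Adj := Classical.decRel _
  α • G.degMatrix ℝ + (1 - α) • G.adjMatrix ℝ

/-- The `A_α`-index of `G`: the largest eigenvalue of the real symmetric matrix `A_α(G)`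
(see `index_isGreatest` for the fact that this supremum is a maximum). -/
noncomputable def index {V : Type*} [Fintype V] [DecidableEq V] (α : ℝ) (G : SimpleGraph V) : ℝ :=
  sSup (spectrum ℝ (matrix α G))

theorem matrix_isHermitian {V : Type*} [Fintype V] [DecidableEq V] (α : ℝ) (G : SimpleGraph V) :
    (matrix α G).IsHermitian := by
  classical
  unfold matrix
  refine Matrix.IsHermitian.ext fun i j => ?_
  by_cases h : i = j
  · subst h; simp
  · simp [SimpleGraph.degMatrix, SimpleGraph.adjMatrix_apply, Matrix.diagonal_apply, h, Ne.symm h,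
      G.adj_comm]

theorem index_isGreatest {V : Type*} [Fintype V] [DecidableEq V] [Nonempty V] (α : ℝ)
    (G : SimpleGraph V) : IsGreatest (spectrum ℝ (matrix α G)) (index α G) := by
  have h := (matrix_isHermitian α G).spectrum_real_eq_range_eigenvalues
  unfold index
  rw [h]
  exact ⟨(Set.range_nonempty _).csSup_mem (Set.finite_range _),
    fun x hx => le_csSup (Set.finite_range _).bddAbove hx⟩

/-- `G` belongs to the class of connected graphs on `n` vertices with independence number `i`. -/
def InClass {V : Type*} [Fintype V] (n i : ℕ) (G : SimpleGraph V) : Prop :=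
  Fintype.card V = n ∧ G.Connected ∧ G.indepNum = i

/-- `G` has the minimum `A_α`-index among all connected graphs on `n` vertices with independence
number `i`. Every graph on `n` vertices is isomorphic to one with vertex set `Fin n`, so it is
enough to compare `G` with the graphs on `Fin n`. -/
def IsMinimizer {V : Type*} [Fintype V] [DecidableEq V] (α : ℝ) (n i : ℕ) (G : SimpleGraph V) :
    Prop :=
  InClass n i G ∧ ∀ H : SimpleGraph (Fin n), InClass n i H → index α G ≤ index α H

/-- Vertices of the tree `H3 s t k`: the five vertices of a path, then `s`, `t` and `k` pendant
vertices. -/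
abbrev H3Vertex (s t k : ℕ) : Type := Fin 5 ⊕ (Fin s ⊕ (Fin t ⊕ Fin k))

/-- Edges of `H3 s t k`, each listed in one direction. -/
def H3Rel (s t k : ℕ) : H3Vertex s t k → H3Vertex s t k → Prop
  | .inl a, .inl b => a.val + 1 = b.val
  | .inl a, .inr (.inl _) => a = 0
  | .inl a, .inr (.inr (.inl _)) => a = 2
  | .inl a, .inr (.inr (.inr _)) => a = 4
  | .inr _, _ => False

/-- The tree obtained from the path on the vertices `0, 1, 2, 3, 4` (in this order) by attaching
`s` pendant edges at the end `0`, `t` pendant edges at the middle vertex `2` and `k` pendant edges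
at the end `4`. Equivalently: take a path `v₁ v₂ v₃`, attach `s`, `t`, `k` pendant edges to
`v₁`, `v₂`, `v₃` and subdivide both edges `v₁v₂` and `v₂v₃` once. -/
def H3 (s t k : ℕ) : SimpleGraph (H3Vertex s t k) := SimpleGraph.fromRel (H3Rel s t k)

end AAlpha

/-! Let `L` be the index of a minimizer `G` and `x` its Perron vector. The complement of a maximum
independent set consists of three centres, and every other vertex is adjacent to centres only.
Eliminating those vertices from the eigenvalue equation leaves three inequalities between the values
of `x` at the centres: a pendant vertex costs its centre `pend α L` on the diagonal, a vertex
joining two centres costs each `α + conn α L` and couples them by `conn α L`, and any further edge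
only adds to the cost. Conversely, a positive strict supersolution of the 3×3 system of some `H3 s t
k` extends to the whole tree, so that tree has index below `L` (`index_lt_of_supersolution`).
Minimality therefore excludes `StrictFeasible` at `L` for every `H3 s t k` of order `n`.

By connectedness some centre is linked to both others, each time by an edge or by a common
neighbour. Subdividing an edge while deleting a pendant vertex (`subdivide_left`,
`subdivide_right`), or splitting a neighbour common to all three centres
(`strictFeasible_of_common_neighbor`), creates slack, and so does a surplus edge. Hence `G` is
itself some `H3 s t k`.

Eliminating the end centres as well turns feasibility into a Schur complement inequality `r ^ 2 / A
+ r ^ 2 / C ≤ B`, with `r = conn α L`. Balancing the ends enlarges `A * C` at constant `A + C`,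
which gives `|s - k| ≤ 1`. For the exact shapes, a wrong distribution either has a centre of too
large degree, which makes `L` so large that the target tree is strictly feasible, or is one of a few
near misses that are compared with the target directly. -/

namespace AAlpha

open Finset Matrix

/-! ### Perron–Frobenius facts for the `A_α`-matrix. -/

section Spectral

variable {V : Type*} [Fintype V] [DecidableEq V]

theorem matrix_mulVec_apply (α : ℝ) (G : SimpleGraph V) [DecidableRel G.Adj] (x : V → ℝ) (v : V) :
    (matrix α G *ᵥ x) v = ∑ w with G.Adj v w, (α * x v + (1 - α) * x w) := by
  unfold matrix
  rw [Matrix.add_mulVec, Matrix.smul_mulVec, Matrix.smul_mulVec]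
  simp only [Pi.add_apply, Pi.smul_apply, smul_eq_mul, SimpleGraph.degMatrix_mulVec_apply,
    SimpleGraph.adjMatrix_mulVec_apply]
  rw [Finset.sum_add_distrib, Finset.sum_const, ← Finset.mul_sum, nsmul_eq_mul]
  have h : ∀ h : Fintype (G.neighborSet v),
      @SimpleGraph.neighborFinset V G v h = univ.filter fun w => G.Adj v w := by
    intro h; ext w; simp
  rw [← SimpleGraph.card_neighborFinset_eq_degree]
  simp only [h]
  ring

theorem matrix_apply_nonneg {α : ℝ} (h0 : 0 ≤ α) (h1 : α ≤ 1) (G : SimpleGraph V) (v w : V) :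
    0 ≤ matrix α G v w := by
  classical
  unfold matrix
  have : 0 ≤ 1 - α := by linarith
  simp only [Matrix.add_apply, Matrix.smul_apply, smul_eq_mul, SimpleGraph.degMatrix,
    Matrix.diagonal_apply, SimpleGraph.adjMatrix_apply]
  split_ifs <;> positivity

theorem exists_eigenvector_of_mem_spectrum {A : Matrix V V ℝ} {μ : ℝ} (h : μ ∈ spectrum ℝ A) :
    ∃ z : V → ℝ, z ≠ 0 ∧ A *ᵥ z = μ • z := by
  rw [← Matrix.spectrum_toLin'] at h
  obtain ⟨z, hz⟩ := (Module.End.hasEigenvalue_iff_mem_spectrum.mpr h).exists_hasEigenvector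
  exact ⟨z, hz.2, by simpa using hz.apply_eq_smul⟩

/-- A positive strict supersolution bounds the index from above. -/
theorem index_lt_of_supersolution [Nonempty V] {α L : ℝ} (h0 : 0 ≤ α) (h1 : α ≤ 1)
    (G : SimpleGraph V) (y : V → ℝ) (hy : ∀ v, 0 < y v)
    (h : ∀ v, (matrix α G *ᵥ y) v < L * y v) : index α G < L := by
  obtain ⟨z, hz, hev⟩ := exists_eigenvector_of_mem_spectrum (index_isGreatest α G).1
  -- Collatz–Wielandt comparison: at a vertex maximizing `|z| / y`, the eigenvalue equation for `z`
  -- is dominated by `c` times the supersolution inequality for `y`.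
  obtain ⟨v, -, hv⟩ := Finset.exists_max_image univ (fun v => |z v| / y v) univ_nonempty
  set c := |z v| / y v with hc
  have hle : ∀ w, |z w| ≤ c * y w := fun w => (div_le_iff₀ (hy w)).1 (hv w (mem_univ w))
  have hzv : |z v| = c * y v := by rw [hc, div_mul_cancel₀ _ (hy v).ne']
  have hcpos : 0 < c := by
    obtain ⟨w, hw⟩ := Function.ne_iff.1 hz
    have h2 : 0 < |z w| := abs_pos.2 hw
    have := hle w
    by_contra hcon
    nlinarith [hy w]
  have h2 : |index α G * z v| ≤ c * (matrix α G *ᵥ y) v := by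
    have h3 : index α G * z v = ∑ w, matrix α G v w * z w := by
      have := congrFun hev v
      simpa [Matrix.mulVec, dotProduct] using this.symm
    rw [h3]
    refine (Finset.abs_sum_le_sum_abs _ _).trans ?_
    simp only [Matrix.mulVec, dotProduct, Finset.mul_sum]
    refine Finset.sum_le_sum fun w _ => ?_
    rw [abs_mul, abs_of_nonneg (matrix_apply_nonneg h0 h1 G v w)]
    nlinarith [hle w, matrix_apply_nonneg h0 h1 G v w]
  have h4 : c * (matrix α G *ᵥ y) v < L * |z v| := by
    rw [hzv]; nlinarith [h v]
  rw [abs_mul] at h2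
  have h5 : 0 < |z v| := by rw [hzv]; exact mul_pos hcpos (hy v)
  have h6 : index α G ≤ |index α G| := le_abs_self _
  by_contra hcon
  nlinarith

theorem index_sub_posSemidef [Nonempty V] (α : ℝ) (G : SimpleGraph V) :
    (index α G • (1 : Matrix V V ℝ) - matrix α G).PosSemidef := by
  have hH : (index α G • (1 : Matrix V V ℝ) - matrix α G).IsHermitian := by
    refine Matrix.IsHermitian.sub ?_ (matrix_isHermitian α G)
    rw [Matrix.IsHermitian, Matrix.conjTranspose_smul]; simp
  rw [hH.posSemidef_iff_eigenvalues_nonneg]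
  intro i
  have hi := hH.eigenvalues_mem_spectrum_real i
  set μ := hH.eigenvalues i
  obtain ⟨z, hz, hev⟩ := exists_eigenvector_of_mem_spectrum hi
  have hev' : matrix α G *ᵥ z = (index α G - μ) • z := by
    rw [Matrix.sub_mulVec, Matrix.smul_mulVec, Matrix.one_mulVec] at hev
    rw [sub_smul, ← hev]; abel
  have : index α G - μ ∈ spectrum ℝ (matrix α G) := by
    rw [← Matrix.spectrum_toLin', ← Module.End.hasEigenvalue_iff_mem_spectrum]
    exact Module.End.hasEigenvalue_of_hasEigenvector
      ⟨Module.End.mem_eigenspace_iff.2 (by simpa using hev'), hz⟩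
  have := (index_isGreatest α G).2 this
  simp only [Pi.zero_apply]
  linarith

theorem _root_.SimpleGraph.Connected.mem_of_closed {V : Type*} {G : SimpleGraph V}
    (hG : G.Connected) {S : Set V} {a : V} (ha : a ∈ S)
    (hS : ∀ v w, v ∈ S → G.Adj v w → w ∈ S) (b : V) : b ∈ S := by
  obtain ⟨p⟩ := hG.preconnected a b
  induction p with
  | nil => exact ha
  | cons h _ ih => exact ih (hS _ _ ha h)

/-- Perron vector of a connected graph. -/
theorem exists_perron {α : ℝ} (h0 : 0 ≤ α) (h1 : α < 1)
    {G : SimpleGraph V} (hG : G.Connected) :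
    ∃ x : V → ℝ, (∀ v, 0 < x v) ∧ ∀ v, (matrix α G *ᵥ x) v = index α G * x v := by
  classical
  have := hG.nonempty
  obtain ⟨z, hz, hev⟩ := exists_eigenvector_of_mem_spectrum (index_isGreatest α G).1
  set x : V → ℝ := fun v => |z v| with hx
  have hP := index_sub_posSemidef α G
  have hx0 : ∀ v, 0 ≤ x v := fun v => abs_nonneg _
  -- Passing from `z` to `|z|` does not decrease the quadratic form of a nonnegative matrix, so
  -- `|z|` also attains the maximal Rayleigh quotient and lies in the kernel of the semidefinite
  -- matrix.
  have hzero : star x ⬝ᵥ ((index α G • (1 : Matrix V V ℝ) - matrix α G) *ᵥ x) = 0 := by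
    refine le_antisymm ?_ (hP.dotProduct_mulVec_nonneg x)
    have hz0 : z ⬝ᵥ ((index α G • (1 : Matrix V V ℝ) - matrix α G) *ᵥ z) = 0 := by
      rw [Matrix.sub_mulVec, Matrix.smul_mulVec, Matrix.one_mulVec, hev, sub_self, dotProduct_zero]
    rw [← hz0]
    rw [Matrix.sub_mulVec, Matrix.smul_mulVec, Matrix.one_mulVec, Matrix.sub_mulVec,
      Matrix.smul_mulVec, Matrix.one_mulVec, dotProduct_sub, dotProduct_sub]
    refine sub_le_sub (le_of_eq ?_) ?_
    · simp only [dotProduct, hx, star_trivial, Pi.smul_apply, smul_eq_mul]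
      refine Finset.sum_congr rfl fun v _ => ?_
      rw [mul_left_comm, abs_mul_abs_self, mul_left_comm]
    · simp only [dotProduct, Matrix.mulVec, Finset.mul_sum]
      refine Finset.sum_le_sum fun v _ => Finset.sum_le_sum fun w _ => ?_
      have hA := matrix_apply_nonneg h0 h1.le G v w
      have h3 : z v * z w ≤ |z v| * |z w| := by rw [← abs_mul]; exact le_abs_self _
      simp only [hx, star_trivial]
      nlinarith
  have hker := (hP.dotProduct_mulVec_zero_iff x).1 hzero
  have hxe : ∀ v, (matrix α G *ᵥ x) v = index α G * x v := by
    intro v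
    have := congrFun hker v
    rw [Matrix.sub_mulVec, Matrix.smul_mulVec, Matrix.one_mulVec] at this
    simp only [Pi.sub_apply, Pi.smul_apply, smul_eq_mul, Pi.zero_apply] at this
    linarith
  refine ⟨x, fun v => ?_, hxe⟩
  by_contra hcon
  have hv : x v = 0 := le_antisymm (not_lt.1 hcon) (hx0 v)
  refine hz (funext fun b => ?_)
  -- Where `x` vanishes, the eigenvalue equation is a vanishing sum of nonnegative terms, so the
  -- zero set is closed under adjacency.
  have hb : b ∈ {v | x v = 0} := by
    refine hG.mem_of_closed hv (fun u w hu huw => ?_) b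
    have h2 := hxe u
    rw [matrix_mulVec_apply, show x u = 0 from hu, mul_zero, mul_zero,
      Finset.sum_eq_zero_iff_of_nonneg] at h2
    · have := h2 w (by simpa using huw)
      rw [zero_add, mul_eq_zero] at this
      exact this.resolve_left (by linarith)
    · intro w _
      have : 0 ≤ 1 - α := by linarith
      have := hx0 w
      positivity
  simpa [hx] using hb

theorem index_congr {W : Type*} [Fintype W] [DecidableEq W] (α : ℝ) {G : SimpleGraph V}
    {H : SimpleGraph W} (e : G ≃g H) : index α G = index α H := by
  classical
  unfold index
  have : matrix α H = Matrix.reindexAlgEquiv ℝ ℝ e.toEquiv (matrix α G) := by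
    ext i j
    obtain ⟨i, rfl⟩ := e.surjective i
    obtain ⟨j, rfl⟩ := e.surjective j
    have hd : ∀ (h : DecidableRel G.Adj) (h' : DecidableRel H.Adj), H.degree (e i) = G.degree i :=
      fun h h' => e.degree_eq i
    simp only [matrix, Matrix.add_apply, Matrix.smul_apply, smul_eq_mul, SimpleGraph.degMatrix,
      Matrix.diagonal_apply, SimpleGraph.adjMatrix_apply, Matrix.coe_reindexAlgEquiv,
      Matrix.reindex_apply, Matrix.submatrix_apply, e.map_adj_iff, e.injective.eq_iff]
    have : ∀ k, e.toEquiv.symm (e k) = k := fun k => e.toEquiv.symm_apply_apply k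
    simp only [hd, this]
    congr! 4
    exact congrArg (fun u => G.degree u) (this i).symm
  rw [this, AlgEquiv.spectrum_eq]

end Spectral

/-! ### The trees `H3 s t k`: adjacency, independence number, upper bound for the index. -/

section H3

theorem H3_adj_inl_inl {s t k : ℕ} (a b : Fin 5) :
    (H3 s t k).Adj (.inl a) (.inl b) ↔ a.val + 1 = b.val ∨ b.val + 1 = a.val := by
  simp only [H3, SimpleGraph.fromRel_adj, H3Rel, ne_eq, Sum.inl.injEq]
  constructor
  · exact fun h => h.2
  · refine fun h => ⟨?_, h⟩
    rintro rfl
    omega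

theorem H3_adj_inl_s {s t k : ℕ} (a : Fin 5) (i : Fin s) :
    (H3 s t k).Adj (.inl a) (.inr (.inl i)) ↔ a = 0 := by
  simp [H3, SimpleGraph.fromRel_adj, H3Rel]

theorem H3_adj_inl_t {s t k : ℕ} (a : Fin 5) (i : Fin t) :
    (H3 s t k).Adj (.inl a) (.inr (.inr (.inl i))) ↔ a = 2 := by
  simp [H3, SimpleGraph.fromRel_adj, H3Rel]

theorem H3_adj_inl_k {s t k : ℕ} (a : Fin 5) (i : Fin k) :
    (H3 s t k).Adj (.inl a) (.inr (.inr (.inr i))) ↔ a = 4 := by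
  simp [H3, SimpleGraph.fromRel_adj, H3Rel]

theorem H3_adj_s_inl {s t k : ℕ} (a : Fin 5) (i : Fin s) :
    (H3 s t k).Adj (.inr (.inl i)) (.inl a) ↔ a = 0 := by
  rw [SimpleGraph.adj_comm, H3_adj_inl_s]

theorem H3_adj_t_inl {s t k : ℕ} (a : Fin 5) (i : Fin t) :
    (H3 s t k).Adj (.inr (.inr (.inl i))) (.inl a) ↔ a = 2 := by
  rw [SimpleGraph.adj_comm, H3_adj_inl_t]

theorem H3_adj_k_inl {s t k : ℕ} (a : Fin 5) (i : Fin k) :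
    (H3 s t k).Adj (.inr (.inr (.inr i))) (.inl a) ↔ a = 4 := by
  rw [SimpleGraph.adj_comm, H3_adj_inl_k]

theorem H3_adj_inr_inr {s t k : ℕ} (a b : Fin s ⊕ (Fin t ⊕ Fin k)) :
    ¬ (H3 s t k).Adj (.inr a) (.inr b) := by
  simp [H3, SimpleGraph.fromRel_adj, H3Rel]

theorem H3_connected (s t k : ℕ) : (H3 s t k).Connected := by
  have h01 : (H3 s t k).Reachable (.inl 1) (.inl 0) :=
    SimpleGraph.Adj.reachable ((H3_adj_inl_inl _ _).2 (by simp))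
  have h12 : (H3 s t k).Reachable (.inl 2) (.inl 1) :=
    SimpleGraph.Adj.reachable ((H3_adj_inl_inl _ _).2 (by simp))
  have h23 : (H3 s t k).Reachable (.inl 3) (.inl 2) :=
    SimpleGraph.Adj.reachable ((H3_adj_inl_inl _ _).2 (by simp))
  have h34 : (H3 s t k).Reachable (.inl 4) (.inl 3) :=
    SimpleGraph.Adj.reachable ((H3_adj_inl_inl _ _).2 (by simp))
  have h20 := h12.trans h01
  have h30 := h23.trans h20
  have h40 := h34.trans h30
  have key : ∀ v, (H3 s t k).Reachable v (.inl 0) := by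
    rintro (a | a | a | a)
    · fin_cases a
      · exact SimpleGraph.Reachable.refl _
      exacts [h01, h20, h30, h40]
    · exact SimpleGraph.Adj.reachable ((H3_adj_s_inl _ _).2 rfl)
    · exact (SimpleGraph.Adj.reachable ((H3_adj_t_inl _ _).2 rfl)).trans h20
    · exact (SimpleGraph.Adj.reachable ((H3_adj_k_inl _ _).2 rfl)).trans h40
  exact ⟨fun v w => (key v).trans (key w).symm⟩

/-- A matching of three edges has, for each edge, an end outside the independent set, and these ends
are distinct. -/
theorem _root_.SimpleGraph.IsIndepSet.card_add_three_le {V : Type*} [Fintype V] [DecidableEq V]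
    {G : SimpleGraph V} {J : Finset V} (hJ : G.IsIndepSet J) {a b c d e f : V}
    (hab : G.Adj a b) (hcd : G.Adj c d) (hef : G.Adj e f) (hac : a ≠ c) (had : a ≠ d)
    (hae : a ≠ e) (haf : a ≠ f) (hbc : b ≠ c) (hbd : b ≠ d) (hbe : b ≠ e) (hbf : b ≠ f)
    (hce : c ≠ e) (hcf : c ≠ f) (hde : d ≠ e) (hdf : d ≠ f) :
    #J + 3 ≤ Fintype.card V := by
  have key : ∀ {u v : V}, G.Adj u v → ∃ w ∈ Jᶜ, w = u ∨ w = v := by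
    intro u v huv
    by_cases hu : u ∈ J
    · refine ⟨v, Finset.mem_compl.2 fun hv => ?_, Or.inr rfl⟩
      exact hJ (Finset.mem_coe.2 hu) (Finset.mem_coe.2 hv) huv.ne huv
    · exact ⟨u, Finset.mem_compl.2 hu, Or.inl rfl⟩
  obtain ⟨x, hx, hx'⟩ := key hab
  obtain ⟨y, hy, hy'⟩ := key hcd
  obtain ⟨z, hz, hz'⟩ := key hef
  have h3 : #({x, y, z} : Finset V) = 3 := by
    apply Finset.card_eq_three.2 ⟨x, y, z, ?_, ?_, ?_, rfl⟩
    all_goals grind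
  have h4 : #({x, y, z} : Finset V) ≤ #Jᶜ := by
    apply Finset.card_le_card
    intro w hw
    simp only [Finset.mem_insert, Finset.mem_singleton] at hw
    rcases hw with rfl | rfl | rfl <;> assumption
  have := Finset.card_add_card_compl J
  omega

theorem H3_indepNum {s t k : ℕ} (h : 0 < s + t + k) :
    (H3 s t k).indepNum = s + t + k + 2 := by
  classical
  have hcard : Fintype.card (H3Vertex s t k) = s + t + k + 5 := by
    simp [H3Vertex]; ring
  apply le_antisymm
  · obtain ⟨J, hJ⟩ := (H3 s t k).exists_isNIndepSet_indepNum
    have h01 : (H3 s t k).Adj (.inl 0) (.inl 1) := (H3_adj_inl_inl _ _).2 (by simp)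
    have h12 : (H3 s t k).Adj (.inl 1) (.inl 2) := (H3_adj_inl_inl _ _).2 (by simp)
    have h23 : (H3 s t k).Adj (.inl 2) (.inl 3) := (H3_adj_inl_inl _ _).2 (by simp)
    have h34 : (H3 s t k).Adj (.inl 3) (.inl 4) := (H3_adj_inl_inl _ _).2 (by simp)
    have : #J + 3 ≤ Fintype.card (H3Vertex s t k) := by
      -- A 3-matching uses two edges of the path and one pendant edge; which ones depends on where a
      -- pendant vertex exists.
      rcases Nat.eq_zero_or_pos t with ht | ht
      · rcases Nat.eq_zero_or_pos s with hs | hs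
        · have hk : 0 < k := by omega
          refine hJ.1.card_add_three_le h01 h23
            ((H3_adj_inl_k (s := s) (t := t) 4 (⟨0, hk⟩ : Fin k)).2 rfl) ?_ ?_ ?_ ?_ ?_ ?_ ?_ ?_ ?_ ?_ ?_ ?_
            <;> simp
        · refine hJ.1.card_add_three_le h12 h34
            ((H3_adj_inl_s (k := k) (t := t) 0 (⟨0, hs⟩ : Fin s)).2 rfl) ?_ ?_ ?_ ?_ ?_ ?_ ?_ ?_ ?_ ?_ ?_ ?_
            <;> simp
      · refine hJ.1.card_add_three_le h01 h34
            ((H3_adj_inl_t (k := k) (s := s) 2 (⟨0, ht⟩ : Fin t)).2 rfl) ?_ ?_ ?_ ?_ ?_ ?_ ?_ ?_ ?_ ?_ ?_ ?_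
            <;> simp
    have := hJ.2
    omega
  · set J : Finset (H3Vertex s t k) := ({.inl 0, .inl 2, .inl 4} : Finset (H3Vertex s t k))ᶜ with hJ
    have hJc : #J = s + t + k + 2 := by
      rw [hJ, Finset.card_compl, hcard]
      have : #({.inl 0, .inl 2, .inl 4} : Finset (H3Vertex s t k)) = 3 :=
        Finset.card_eq_three.2 ⟨_, _, _, by simp, by simp, by simp, rfl⟩
      omega
    rw [← hJc]
    refine SimpleGraph.IsIndepSet.card_le_indepNum ?_
    intro a ha b hb _ hadj
    simp only [hJ, Finset.coe_compl, Set.mem_compl_iff, Finset.coe_insert, Finset.coe_singleton,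
      Set.mem_insert_iff, Set.mem_singleton_iff, not_or] at ha hb
    rcases a with a | a | a | a
    · rcases b with b | b | b | b
      · rw [H3_adj_inl_inl] at hadj
        fin_cases a <;> fin_cases b <;> simp_all
      · rw [H3_adj_inl_s] at hadj; simp_all
      · rw [H3_adj_inl_t] at hadj; simp_all
      · rw [H3_adj_inl_k] at hadj; simp_all
    all_goals
      rcases b with b | b
      · first
          | rw [H3_adj_s_inl] at hadj
          | rw [H3_adj_t_inl] at hadj
          | rw [H3_adj_k_inl] at hadj
        simp_all
      · exact H3_adj_inr_inr _ _ hadj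

/-- The bound `6 ≤ n` leaves at least one pendant vertex; without any, the tree is a five-vertex
path with independence number 3, not `n - 3 = 2`. -/
theorem IsMinimizer.index_le_H3 {V : Type*} [Fintype V] [DecidableEq V] {α : ℝ} {n : ℕ}
    {G : SimpleGraph V} (hn : 6 ≤ n) (hG : IsMinimizer α n (n - 3) G) {s t k : ℕ}
    (h : s + t + k = n - 5) : index α G ≤ index α (H3 s t k) := by
  have hcard : Fintype.card (H3Vertex s t k) = n := by
    simp [H3Vertex]; omega
  have e : H3Vertex s t k ≃ Fin n := Fintype.equivFinOfCardEq hcard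
  have i : H3 s t k ≃g (H3 s t k).map e.toEmbedding := SimpleGraph.Iso.map e _
  rw [index_congr α i]
  refine hG.2 _ ⟨by simp, i.connected_iff.1 (H3_connected s t k), ?_⟩
  rw [show n - 3 = s + t + k + 2 by omega, ← H3_indepNum (by omega)]
  apply le_antisymm
  · obtain ⟨J, hJ⟩ := ((H3 s t k).map e.toEmbedding).exists_isNIndepSet_indepNum
    rw [← hJ.2, ← Finset.card_map i.symm.toEquiv.toEmbedding]
    refine SimpleGraph.IsIndepSet.card_le_indepNum ?_
    intro a ha b hb hab hadj
    simp only [Finset.coe_map, Set.mem_image] at ha hb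
    obtain ⟨a, ha, rfl⟩ := ha
    obtain ⟨b, hb, rfl⟩ := hb
    exact hJ.1 ha hb (fun h => hab (by rw [h])) (i.symm.map_adj_iff.1 hadj)
  · obtain ⟨J, hJ⟩ := (H3 s t k).exists_isNIndepSet_indepNum
    rw [← hJ.2, ← Finset.card_map i.toEquiv.toEmbedding]
    refine SimpleGraph.IsIndepSet.card_le_indepNum ?_
    intro a ha b hb hab hadj
    simp only [Finset.coe_map, Set.mem_image] at ha hb
    obtain ⟨a, ha, rfl⟩ := ha
    obtain ⟨b, hb, rfl⟩ := hb
    exact hJ.1 ha hb (fun h => hab (by rw [h])) (i.map_adj_iff.1 hadj)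

/-- Upper bound for the index of `H3 s t k` from a positive supersolution of the reduced system on
the three centres. -/
theorem index_H3_lt {α L : ℝ} (h0 : 0 ≤ α) (h1 : α < 1) (hL : 2 * α < L) {s t k : ℕ}
    {y₁ y₂ y₃ : ℝ} (hy₁ : 0 < y₁) (hy₂ : 0 < y₂) (hy₃ : 0 < y₃)
    (e₁ : s * (α * y₁ + (1 - α) * ((1 - α) * y₁ / (L - α))) +
      (α * y₁ + (1 - α) * ((1 - α) * (y₁ + y₂) / (L - 2 * α))) < L * y₁)
    (e₂ : t * (α * y₂ + (1 - α) * ((1 - α) * y₂ / (L - α))) +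
      (α * y₂ + (1 - α) * ((1 - α) * (y₁ + y₂) / (L - 2 * α))) +
      (α * y₂ + (1 - α) * ((1 - α) * (y₂ + y₃) / (L - 2 * α))) < L * y₂)
    (e₃ : k * (α * y₃ + (1 - α) * ((1 - α) * y₃ / (L - α))) +
      (α * y₃ + (1 - α) * ((1 - α) * (y₂ + y₃) / (L - 2 * α))) < L * y₃) :
    index α (H3 s t k) < L := by
  classical
  have hb : 0 < 1 - α := by linarith
  have hLa : 0 < L - α := by linarith
  have hL2a : 0 < L - 2 * α := by linarith
  -- Solving exactly at the non-central vertices would give equality there. Adding a small `δ` to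
  -- their values makes those rows strict, and the strict rows at the centres survive by continuity.
  obtain ⟨δ, hδ, d₁, d₂, d₃⟩ : ∃ δ > 0,
      s * (α * y₁ + (1 - α) * ((1 - α) * y₁ / (L - α) + δ)) +
        (α * y₁ + (1 - α) * ((1 - α) * (y₁ + y₂) / (L - 2 * α) + δ)) < L * y₁ ∧
      t * (α * y₂ + (1 - α) * ((1 - α) * y₂ / (L - α) + δ)) +
        (α * y₂ + (1 - α) * ((1 - α) * (y₁ + y₂) / (L - 2 * α) + δ)) +
        (α * y₂ + (1 - α) * ((1 - α) * (y₂ + y₃) / (L - 2 * α) + δ)) < L * y₂ ∧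
      k * (α * y₃ + (1 - α) * ((1 - α) * y₃ / (L - α) + δ)) +
        (α * y₃ + (1 - α) * ((1 - α) * (y₂ + y₃) / (L - 2 * α) + δ)) < L * y₃ := by
    have c₁ : ∀ᶠ δ in nhds (0 : ℝ), s * (α * y₁ + (1 - α) * ((1 - α) * y₁ / (L - α) + δ)) +
        (α * y₁ + (1 - α) * ((1 - α) * (y₁ + y₂) / (L - 2 * α) + δ)) < L * y₁ :=
      ContinuousAt.eventually_lt (by fun_prop) (by fun_prop) (by simpa using e₁)
    have c₂ : ∀ᶠ δ in nhds (0 : ℝ), t * (α * y₂ + (1 - α) * ((1 - α) * y₂ / (L - α) + δ)) +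
        (α * y₂ + (1 - α) * ((1 - α) * (y₁ + y₂) / (L - 2 * α) + δ)) +
        (α * y₂ + (1 - α) * ((1 - α) * (y₂ + y₃) / (L - 2 * α) + δ)) < L * y₂ :=
      ContinuousAt.eventually_lt (by fun_prop) (by fun_prop) (by simpa using e₂)
    have c₃ : ∀ᶠ δ in nhds (0 : ℝ), k * (α * y₃ + (1 - α) * ((1 - α) * y₃ / (L - α) + δ)) +
        (α * y₃ + (1 - α) * ((1 - α) * (y₂ + y₃) / (L - 2 * α) + δ)) < L * y₃ :=
      ContinuousAt.eventually_lt (by fun_prop) (by fun_prop) (by simpa using e₃)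
    have hpos : ∀ᶠ δ in nhdsWithin (0 : ℝ) (Set.Ioi 0), 0 < δ := eventually_mem_nhdsWithin
    obtain ⟨δ, h, h', h'', h'''⟩ := (hpos.and ((c₁.filter_mono nhdsWithin_le_nhds).and
      ((c₂.filter_mono nhdsWithin_le_nhds).and (c₃.filter_mono nhdsWithin_le_nhds)))).exists
    exact ⟨δ, h, h', h'', h'''⟩
  have leaf : ∀ y : ℝ, α * ((1 - α) * y / (L - α) + δ) + (1 - α) * y <
      L * ((1 - α) * y / (L - α) + δ) := by
    intro y
    have : (L - α) * ((1 - α) * y / (L - α)) = (1 - α) * y := by field_simp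
    nlinarith [mul_pos hLa hδ]
  have link : ∀ y z : ℝ, α * ((1 - α) * (y + z) / (L - 2 * α) + δ) + (1 - α) * y +
      (α * ((1 - α) * (y + z) / (L - 2 * α) + δ) + (1 - α) * z) <
      L * ((1 - α) * (y + z) / (L - 2 * α) + δ) := by
    intro y z
    have : (L - 2 * α) * ((1 - α) * (y + z) / (L - 2 * α)) = (1 - α) * (y + z) := by field_simp
    nlinarith [mul_pos hL2a hδ]
  refine index_lt_of_supersolution h0 h1.le _ (Sum.elim
    ![y₁, (1 - α) * (y₁ + y₂) / (L - 2 * α) + δ, y₂, (1 - α) * (y₂ + y₃) / (L - 2 * α) + δ, y₃]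
    (Sum.elim (fun _ => (1 - α) * y₁ / (L - α) + δ)
      (Sum.elim (fun _ => (1 - α) * y₂ / (L - α) + δ)
        (fun _ => (1 - α) * y₃ / (L - α) + δ)))) ?_ ?_
  · rintro (v | v | v | v)
    · fin_cases v <;> simp <;> positivity
    all_goals simp; positivity
  · rintro (v | v | v | v)
    · fin_cases v <;>
      simp [matrix_mulVec_apply, Finset.sum_filter, Fin.sum_univ_five, H3_adj_inl_inl, H3_adj_inl_s,
        H3_adj_inl_t, H3_adj_inl_k]
      · linarith
      · exact link _ _
      · linarith
      · exact link _ _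
      · linarith
    all_goals
      simp [matrix_mulVec_apply, Finset.sum_filter, H3_adj_s_inl,
        H3_adj_t_inl, H3_adj_k_inl, H3_adj_inr_inr]
      exact leaf _

end H3

/-! ### The reduced system on the three centres and its transformations. -/

section Reduced

/-- Contribution of a pendant vertex to the diagonal of the reduced system. -/
noncomputable def pend (α L : ℝ) : ℝ := α + (1 - α) ^ 2 / (L - α)

/-- Contribution of a vertex of degree two to the off-diagonal of the reduced system. -/
noncomputable def conn (α L : ℝ) : ℝ := (1 - α) ^ 2 / (L - 2 * α)

/-- The bounds on `L` which hold for the index of a graph with a vertex of degree at least three. -/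
structure Large (α L : ℝ) : Prop where
  nonneg : 0 ≤ α
  lt_one : α < 1
  lt : 3 * α < L
  le_mul : 3 * (1 - α) ^ 2 ≤ (L - 3 * α) * (L - α)

/-- The reduced system of `H3 s t k` at `L` is feasible. -/
def Feasible (α L : ℝ) (s t k : ℕ) : Prop :=
  0 < L - s * pend α L - α - conn α L ∧ 0 < L - k * pend α L - α - conn α L ∧
    conn α L ^ 2 / (L - s * pend α L - α - conn α L) +
      conn α L ^ 2 / (L - k * pend α L - α - conn α L) ≤
        L - t * pend α L - 2 * α - 2 * conn α L

/-- The reduced system of `H3 s t k` at `L` is feasible with slack. -/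
def StrictFeasible (α L : ℝ) (s t k : ℕ) : Prop :=
  0 < L - s * pend α L - α - conn α L ∧ 0 < L - k * pend α L - α - conn α L ∧
    conn α L ^ 2 / (L - s * pend α L - α - conn α L) +
      conn α L ^ 2 / (L - k * pend α L - α - conn α L) <
        L - t * pend α L - 2 * α - 2 * conn α L

/-- The reduced system at `L` is feasible for the tree obtained from `H3 s t k` by contracting one of
the two edges between the first and the second centre. -/
def EdgePathFeasible (α L : ℝ) (s t k : ℕ) : Prop :=
  0 < L - s * pend α L - α ∧ 0 < L - k * pend α L - α - conn α L ∧
    (1 - α) ^ 2 / (L - s * pend α L - α) +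
      conn α L ^ 2 / (L - k * pend α L - α - conn α L) ≤
        L - t * pend α L - 2 * α - conn α L

theorem Feasible.symm {α L : ℝ} {s t k : ℕ} (h : Feasible α L s t k) : Feasible α L k t s :=
  ⟨h.2.1, h.1, by rw [add_comm]; exact h.2.2⟩

theorem StrictFeasible.symm {α L : ℝ} {s t k : ℕ} (h : StrictFeasible α L s t k) :
    StrictFeasible α L k t s :=
  ⟨h.2.1, h.1, by rw [add_comm]; exact h.2.2⟩

namespace Large

variable {α L : ℝ} (h : Large α L)
include h

theorem sub_pos : 0 < L - α := by have := h.nonneg; have := h.lt; linarith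

theorem sub_two_pos : 0 < L - 2 * α := by have := h.nonneg; have := h.lt; linarith

theorem conn_mul : conn α L * (L - 2 * α) = (1 - α) ^ 2 := by
  have := h.sub_two_pos
  rw [conn, div_mul_cancel₀ _ this.ne']

theorem conn_pos : 0 < conn α L := by
  have := h.sub_two_pos
  have : 0 < 1 - α := by have := h.lt_one; linarith
  unfold conn; positivity

/-- The difference equals `α` minus `α` times `(1 - α) ^ 2 / ((L - α) * (L - 2 * α))`, and `le_mul`
bounds this quotient by `1 / 3`. -/
theorem pend_sub_conn_ge : 2 / 3 * α ≤ pend α L - conn α L := by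
  have h1 := h.sub_two_pos
  have h2 := h.sub_pos
  have h3 := h.le_mul
  have h0 := h.nonneg
  have : pend α L - conn α L = α - α * ((1 - α) ^ 2 / ((L - α) * (L - 2 * α))) := by
    unfold pend conn
    rw [mul_div_assoc', add_sub_assoc, div_sub_div _ _ h2.ne' h1.ne', sub_eq_add_neg α, ← neg_div]
    congr 2; ring
  have h4 : (1 - α) ^ 2 / ((L - α) * (L - 2 * α)) ≤ 1 / 3 := by
    rw [div_le_iff₀ (by positivity)]
    nlinarith
  nlinarith

theorem pend_sub_conn_le : pend α L - conn α L ≤ α := by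
  have h1 := h.sub_two_pos
  have h2 := h.sub_pos
  have h0 := h.nonneg
  have : pend α L - conn α L = α - α * ((1 - α) ^ 2 / ((L - α) * (L - 2 * α))) := by
    unfold pend conn
    rw [mul_div_assoc', add_sub_assoc, div_sub_div _ _ h2.ne' h1.ne', sub_eq_add_neg α, ← neg_div]
    congr 2; ring
  have h4 : 0 ≤ (1 - α) ^ 2 / ((L - α) * (L - 2 * α)) := by positivity
  nlinarith

theorem conn_le_pend : conn α L ≤ pend α L := by
  have := h.pend_sub_conn_ge
  have h0 := h.nonneg
  linarith

theorem conn_lt : conn α L < 1 - α := by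
  have h1 := h.sub_two_pos
  have h2 := h.lt_one
  have h3 := h.le_mul
  have : (1 - α) < L - 2 * α := by
    apply lt_of_pow_lt_pow_left₀ 2 h1.le
    nlinarith [sq_nonneg α, sq_pos_of_pos (show 0 < 1 - α by linarith), h.nonneg]
  unfold conn
  rw [div_lt_iff₀ h1]
  nlinarith

/-- This is why two pendant vertices at an end centre suffice for a subdivision there to pay off. -/
theorem add_conn_lt_two_pend : α + conn α L < 2 * pend α L := by
  have h1 := h.pend_sub_conn_ge
  have h2 : α < pend α L := by
    have := h.sub_pos
    have : 0 < 1 - α := by have := h.lt_one; linarith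
    unfold pend
    have : 0 < (1 - α) ^ 2 / (L - α) := by positivity
    linarith
  have := h.nonneg
  linarith

theorem index_H3_lt {s t k : ℕ} (hf : StrictFeasible α L s t k) : index α (H3 s t k) < L := by
  obtain ⟨hA, hC, hB⟩ := hf
  set A := L - s * pend α L - α - conn α L with hAdef
  set C := L - k * pend α L - α - conn α L with hCdef
  set B := L - t * pend α L - 2 * α - 2 * conn α L with hBdef
  have hr := h.conn_pos
  have h1 := h.sub_two_pos
  have h2 := h.sub_pos
  set r := conn α L with hrdef
  set p := pend α L with hpdef
  -- The solution `(r / A, 1, r / C)` is exact in the outer rows. Raising both outer values by `η`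
  -- makes these rows strict and uses half of the slack of the middle row.
  obtain ⟨η, hη, hη'⟩ : ∃ η > 0, r * (r / A + η) + r * (r / C + η) < B := by
    refine ⟨(B - (r ^ 2 / A + r ^ 2 / C)) / (4 * r), div_pos (by linarith) (by positivity), ?_⟩
    have : r * (r / A + (B - (r ^ 2 / A + r ^ 2 / C)) / (4 * r)) +
        r * (r / C + (B - (r ^ 2 / A + r ^ 2 / C)) / (4 * r)) =
        (r ^ 2 / A + r ^ 2 / C) + (B - (r ^ 2 / A + r ^ 2 / C)) / 2 := by
      field_simp; ring
    rw [this]; linarith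
  have hpe : ∀ y : ℝ, α * y + (1 - α) * ((1 - α) * y / (L - α)) = p * y := by
    intro y; rw [hpdef, pend]; ring
  have hre : ∀ y z : ℝ, (1 - α) * ((1 - α) * (y + z) / (L - 2 * α)) = r * (y + z) := by
    intro y z; rw [hrdef, conn]; ring
  have hAy : A * (r / A + η) = r + A * η := by field_simp
  have hCy : C * (r / C + η) = r + C * η := by field_simp
  refine AAlpha.index_H3_lt (y₁ := r / A + η) (y₂ := 1) (y₃ := r / C + η) h.nonneg h.lt_one
    (by linarith) (by positivity) one_pos (by positivity) ?_ ?_ ?_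
  · rw [hpe, hre]; nlinarith [mul_pos hA hη]
  · rw [hpe, hre, hre]; nlinarith
  · rw [hpe, hre]; nlinarith [mul_pos hC hη]

end Large

/-- A positive supersolution of a tridiagonal system gives the Schur complement condition. -/
theorem schur_of_supersolution {A B C g r x₁ x₂ x₃ : ℝ} (hg : 0 < g) (hr : 0 < r) (h₁ : 0 < x₁)
    (h₂ : 0 < x₂) (h₃ : 0 < x₃) (e₁ : g * x₂ ≤ A * x₁) (e₂ : g * x₁ + r * x₃ ≤ B * x₂)
    (e₃ : r * x₂ ≤ C * x₃) : 0 < A ∧ 0 < C ∧ g ^ 2 / A + r ^ 2 / C ≤ B := by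
  have hA : 0 < A := pos_of_mul_pos_left (lt_of_lt_of_le (by positivity) e₁) h₁.le
  have hC : 0 < C := pos_of_mul_pos_left (lt_of_lt_of_le (by positivity) e₃) h₃.le
  refine ⟨hA, hC, ?_⟩
  have k₁ : g ^ 2 / A * x₂ ≤ g * x₁ := by
    rw [div_mul_eq_mul_div, div_le_iff₀ hA]; nlinarith
  have k₃ : r ^ 2 / C * x₂ ≤ r * x₃ := by
    rw [div_mul_eq_mul_div, div_le_iff₀ hC]; nlinarith
  refine le_of_mul_le_mul_right ?_ h₂
  linarith

/-- Slack in any one of the three rows survives the elimination of the outer unknowns. -/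
theorem schur_lt_of_supersolution {A B C g r x₁ x₂ x₃ : ℝ} (hg : 0 < g) (hr : 0 < r) (h₁ : 0 < x₁)
    (h₂ : 0 < x₂) (h₃ : 0 < x₃) (e₁ : g * x₂ ≤ A * x₁) (e₂ : g * x₁ + r * x₃ ≤ B * x₂)
    (e₃ : r * x₂ ≤ C * x₃)
    (hs : g * x₂ < A * x₁ ∨ g * x₁ + r * x₃ < B * x₂ ∨ r * x₂ < C * x₃) :
    0 < A ∧ 0 < C ∧ g ^ 2 / A + r ^ 2 / C < B := by
  obtain ⟨hA, hC, -⟩ := schur_of_supersolution hg hr h₁ h₂ h₃ e₁ e₂ e₃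
  refine ⟨hA, hC, ?_⟩
  have k₁ : g ^ 2 / A * x₂ ≤ g * x₁ := by
    rw [div_mul_eq_mul_div, div_le_iff₀ hA]; nlinarith
  have k₃ : r ^ 2 / C * x₂ ≤ r * x₃ := by
    rw [div_mul_eq_mul_div, div_le_iff₀ hC]; nlinarith
  refine lt_of_mul_lt_mul_right ?_ h₂.le
  rcases hs with hs | hs | hs
  · have : g ^ 2 / A * x₂ < g * x₁ := by
      rw [div_mul_eq_mul_div, div_lt_iff₀ hA]; nlinarith
    linarith
  · linarith
  · have : r ^ 2 / C * x₂ < r * x₃ := by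
      rw [div_mul_eq_mul_div, div_lt_iff₀ hC]; nlinarith
    linarith

/-- With equal ends the two Schur terms coincide, so a product inequality is enough; all three
extremal trees have this shape. -/
theorem strictFeasible_of_mul_lt {α L : ℝ} {u v : ℕ} (hE : 0 < L - u * pend α L - α - conn α L)
    (hm : 2 * conn α L ^ 2 <
      (L - u * pend α L - α - conn α L) * (L - v * pend α L - 2 * α - 2 * conn α L)) :
    StrictFeasible α L u v u := by
  refine ⟨hE, hE, ?_⟩
  rw [← add_div, div_lt_iff₀ hE]
  linarith

/-- Subdividing an edge and deleting a pendant vertex at its first end. -/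
theorem subdivide_left {A B R b p r : ℝ} (hA : 0 < A) (hr : 0 < r) (hB : b ^ 2 / A + R ≤ B)
    (hs : r ^ 2 + r * A < b ^ 2) (hrp : r ≤ p) :
    0 < A + p - r ∧ r ^ 2 / (A + p - r) + R < B - r := by
  -- The deleted pendant vertex pays for the new diagonal cost `r` at the first end; the one at the
  -- second end is paid by the drop of the coupling from `b` to `r`.
  have h1 : r ^ 2 / (A + p - r) ≤ r ^ 2 / A :=
    div_le_div_of_nonneg_left (by positivity) hA (by linarith)
  have h2 : r ^ 2 / A + r < b ^ 2 / A := by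
    rw [div_add' _ _ _ hA.ne', div_lt_div_iff_of_pos_right hA]; exact hs
  exact ⟨by linarith, by linarith⟩

/-- Subdividing an edge and deleting a pendant vertex at its second end. -/
theorem subdivide_right {A B R b p r : ℝ} (hA : 0 < A) (hb : 0 < b) (hr : 0 < r)
    (hB : b ^ 2 / A + R ≤ B)
    (hs : r ^ 2 + r * (B - R) < b ^ 2) (hrp : r ≤ p) :
    0 < A - r ∧ r ^ 2 / (A - r) + R < B + p - r := by
  have hD : 0 < B - R := by have : 0 < b ^ 2 / A := by positivity
                            linarith
  have h1 : b ^ 2 ≤ A * (B - R) := by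
    rw [← div_le_iff₀' hA]; linarith
  have h2 : 0 < A - r := by
    by_contra hcon
    nlinarith [sq_nonneg r]
  refine ⟨h2, ?_⟩
  have h3 : r ^ 2 / (A - r) < B - R := by
    rw [div_lt_iff₀ h2]; nlinarith
  linarith

namespace Large

variable {α L : ℝ} (h : Large α L)
include h

/-- Trees in which the first and second centre are adjacent, and the second and third are joined
by a path of length two. -/
theorem strictFeasible_of_edgePath {s t k : ℕ} (hf : EdgePathFeasible α L s t k) :
    (2 ≤ s → StrictFeasible α L (s - 1) t k) ∧ (1 ≤ t → StrictFeasible α L s (t - 1) k) := by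
  obtain ⟨hA, hC, hB⟩ := hf
  have hr := h.conn_pos
  have h1 := h.sub_two_pos
  have hrp := h.conn_le_pend
  have hb : 0 < 1 - α := by have := h.lt_one; linarith
  have h2p := h.add_conn_lt_two_pend
  have hrm := h.conn_mul
  have hnn := h.nonneg
  unfold StrictFeasible
  set r := conn α L with hrdef
  set p := pend α L with hpdef
  -- Since `r * (L - 2 * α) = (1 - α) ^ 2`, the quadratic hypothesis of the subdivision lemmas
  -- becomes linear in `y`.
  have hlt : ∀ {y : ℝ}, r + y < L - 2 * α → r ^ 2 + r * y < (1 - α) ^ 2 := by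
    intro y hy
    have := mul_lt_mul_of_pos_left hy hr
    linarith [sq r]
  constructor
  · intro hs
    have hs' : (2 : ℝ) ≤ s := by exact_mod_cast hs
    have := subdivide_left (p := p) hA hr hB (hlt (by nlinarith)) hrp
    rw [Nat.cast_sub (by omega)]
    refine ⟨by push_cast; linarith [this.1], hC, ?_⟩
    convert this.2 using 1
    · congr 2; push_cast; ring
    · ring
  · intro ht
    have ht' : (1 : ℝ) ≤ t := by exact_mod_cast ht
    have hR : 0 < r ^ 2 / (L - k * p - α - r) := by positivity
    have := subdivide_right (p := p) hA hb hr hB (hlt (by nlinarith)) hrp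
    rw [Nat.cast_sub (by omega)]
    refine ⟨this.1, hC, ?_⟩
    convert this.2 using 1
    push_cast; ring

/-- Trees in which the second centre is adjacent to the first and to the third one: one edge can be
subdivided. -/
theorem edgePathFeasible_of_edge_edge {s t k : ℕ}
    (hA : 0 < L - s * pend α L - α) (hC : 0 < L - k * pend α L - α)
    (hB : (1 - α) ^ 2 / (L - s * pend α L - α) + (1 - α) ^ 2 / (L - k * pend α L - α) ≤
        L - t * pend α L - 2 * α) :
    (2 ≤ k → EdgePathFeasible α L s t (k - 1)) ∧ (1 ≤ t → EdgePathFeasible α L s (t - 1) k) := by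
  have hr := h.conn_pos
  have h1 := h.sub_two_pos
  have hrp := h.conn_le_pend
  have hb : 0 < 1 - α := by have := h.lt_one; linarith
  have h2p := h.add_conn_lt_two_pend
  have hrm := h.conn_mul
  have hnn := h.nonneg
  unfold EdgePathFeasible
  set r := conn α L with hrdef
  set p := pend α L with hpdef
  rw [add_comm] at hB
  have hlt : ∀ {y : ℝ}, r + y < L - 2 * α → r ^ 2 + r * y < (1 - α) ^ 2 := by
    intro y hy
    have := mul_lt_mul_of_pos_left hy hr
    linarith [sq r]
  constructor
  · intro hs
    have hs' : (2 : ℝ) ≤ k := by exact_mod_cast hs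
    have := subdivide_left (p := p) hC hr hB (hlt (by nlinarith)) hrp
    rw [Nat.cast_sub (by omega)]
    refine ⟨hA, by push_cast; linarith [this.1], ?_⟩
    rw [add_comm]
    convert this.2.le using 1
    congr 2; push_cast; ring
  · intro ht
    have ht' : (1 : ℝ) ≤ t := by exact_mod_cast ht
    have hR : 0 < (1 - α) ^ 2 / (L - s * p - α) := by positivity
    have := subdivide_right (p := p) hC hb hr hB (hlt (by nlinarith)) hrp
    rw [Nat.cast_sub (by omega)]
    refine ⟨hA, this.1, ?_⟩
    rw [add_comm]
    refine this.2.le.trans (le_of_eq ?_)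
    push_cast; ring

/-- Without pendant vertices at the second centre, the middle vertex of the path can take its
place. -/
theorem edgePathFeasible_mirror {s k : ℕ} (hf : EdgePathFeasible α L s 0 k) :
    EdgePathFeasible α L k 0 s := by
  obtain ⟨hA, hC, hB⟩ := hf
  have hr := h.conn_pos
  have hb : 0 < 1 - α := by have := h.lt_one; linarith
  have hrm := h.conn_mul
  unfold EdgePathFeasible
  simp only [Nat.cast_zero, zero_mul, sub_zero] at hB ⊢
  set r := conn α L with hrdef
  set p := pend α L with hpdef
  set b := 1 - α with hbdef
  set A := L - s * p - α with hAd
  set C := L - k * p - α - r with hCd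
  have hAx : A * (b / A) = b := mul_div_cancel₀ _ hA.ne'
  have hCx : C * (r / C) = r := mul_div_cancel₀ _ hC.ne'
  have hw : b * (r * (1 + r / C) / b) = r * (1 + r / C) := mul_div_cancel₀ _ hb.ne'
  have hB' : b * (b / A) + r * (r / C) ≤ L - 2 * α - r := by
    convert hB using 2 <;> ring
  set x₁ := b / A with hx₁
  set x₃ := r / C with hx₃
  -- With value 1 at the second centre, `y` is the value at the middle vertex of the path. The
  -- reversed system is then solved by `(x₃, y, x₁)`.
  set y := r * (1 + x₃) / b with hy
  have hx₁p : 0 < x₁ := by positivity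
  have hx₃p : 0 < x₃ := by positivity
  have hyp : 0 < y := by positivity
  have hb2 : r * (x₁ + y) ≤ b := by
    have : b * (r * (x₁ + y)) ≤ b * b := by nlinarith
    exact le_of_mul_le_mul_left this hb
  have hLy : (L - 2 * α) * y = b * (1 + x₃) := by
    have : b * ((L - 2 * α) * y) = b * (b * (1 + x₃)) := by
      linear_combination (L - 2 * α) * hw + (1 + x₃) * hrm
    exact mul_left_cancel₀ hb.ne' this
  refine schur_of_supersolution hb hr hx₃p hyp hx₁p ?_ ?_ ?_
  · linarith
  · linarith
  · linarith

/-- The only obstruction to subdividing is `t = 0` with `s ≤ 1`. Then `k ≥ 2`, and mirroring puts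
the heavy end at the edge. -/
theorem exists_strictFeasible_of_edgePath {s t k : ℕ} (hn : 3 ≤ s + t + k)
    (hf : EdgePathFeasible α L s t k) :
    ∃ s' t' k', s' + t' + k' + 1 = s + t + k ∧ StrictFeasible α L s' t' k' := by
  rcases Nat.eq_zero_or_pos t with rfl | ht
  · rcases Nat.lt_or_ge s 2 with hs | hs
    · exact ⟨k - 1, 0, s, by omega,
        (h.strictFeasible_of_edgePath (h.edgePathFeasible_mirror hf)).1 (by omega)⟩
    · exact ⟨s - 1, 0, k, by omega, (h.strictFeasible_of_edgePath hf).1 hs⟩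
  · exact ⟨s, t - 1, k, by omega, (h.strictFeasible_of_edgePath hf).2 ht⟩

theorem exists_strictFeasible_of_edge_edge {s t k : ℕ} (hn : 4 ≤ s + t + k)
    (hA : 0 < L - s * pend α L - α) (hC : 0 < L - k * pend α L - α)
    (hB : (1 - α) ^ 2 / (L - s * pend α L - α) + (1 - α) ^ 2 / (L - k * pend α L - α) ≤
        L - t * pend α L - 2 * α) :
    ∃ s' t' k', s' + t' + k' + 2 = s + t + k ∧ StrictFeasible α L s' t' k' := by
  suffices ∃ s' t' k', s' + t' + k' + 1 = s + t + k ∧ EdgePathFeasible α L s' t' k' by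
    obtain ⟨s', t', k', hs, hf⟩ := this
    obtain ⟨s'', t'', k'', hs', hf'⟩ := h.exists_strictFeasible_of_edgePath (by omega) hf
    exact ⟨s'', t'', k'', by omega, hf'⟩
  rcases Nat.eq_zero_or_pos t with rfl | ht
  · rcases Nat.lt_or_ge k 2 with hk | hk
    · exact ⟨k, 0, s - 1, by omega,
        (h.edgePathFeasible_of_edge_edge hC hA (by rw [add_comm]; exact hB)).1 (by omega)⟩
    · exact ⟨s, 0, k - 1, by omega, (h.edgePathFeasible_of_edge_edge hA hC hB).1 hk⟩
  · exact ⟨s, t - 1, k, by omega, (h.edgePathFeasible_of_edge_edge hA hC hB).2 ht⟩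

/-- Trees in which one vertex is adjacent to all three centres. -/
theorem strictFeasible_of_common_neighbor {s t k : ℕ} (ht : 1 ≤ t) {x₁ x₂ x₃ : ℝ} (h₁ : 0 < x₁)
    (h₂ : 0 < x₂) (h₃ : 0 < x₃)
    (e₁ : (1 - α) ^ 2 / (L - 3 * α) * (x₁ + x₂ + x₃) ≤ (L - s * pend α L - α) * x₁)
    (e₂ : (1 - α) ^ 2 / (L - 3 * α) * (x₁ + x₂ + x₃) ≤ (L - t * pend α L - α) * x₂)
    (e₃ : (1 - α) ^ 2 / (L - 3 * α) * (x₁ + x₂ + x₃) ≤ (L - k * pend α L - α) * x₃) :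
    StrictFeasible α L s (t - 1) k := by
  have hr := h.conn_pos
  have h1 := h.sub_two_pos
  have h2 := h.sub_pos
  have h3 : 0 < L - 3 * α := by have := h.lt; linarith
  have hb : 0 < 1 - α := by have := h.lt_one; linarith
  have hnn := h.nonneg
  have hqr : conn α L ≤ (1 - α) ^ 2 / (L - 3 * α) := by
    unfold conn
    exact div_le_div_of_nonneg_left (by positivity) h3 (by linarith)
  -- Balance of the middle row: the degree-three neighbour and one pendant vertex at the second
  -- centre are replaced by two vertices of degree two.
  have hq : 0 ≤ (1 - α) ^ 2 / (L - 3 * α) + pend α L - α - 2 * conn α L := by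
    have : (1 - α) ^ 2 / (L - 3 * α) + pend α L - α - 2 * conn α L =
        2 * α ^ 2 * (1 - α) ^ 2 / ((L - 3 * α) * (L - α) * (L - 2 * α)) := by
      unfold pend conn
      rw [eq_div_iff (by positivity)]
      have k₁ : (1 - α) ^ 2 / (L - 3 * α) * (L - 3 * α) = (1 - α) ^ 2 := div_mul_cancel₀ _ h3.ne'
      have k₂ : (1 - α) ^ 2 / (L - 2 * α) * (L - 2 * α) = (1 - α) ^ 2 := div_mul_cancel₀ _ h1.ne'
      have k₃ : (1 - α) ^ 2 / (L - α) * (L - α) = (1 - α) ^ 2 := div_mul_cancel₀ _ h2.ne'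
      linear_combination (L - α) * (L - 2 * α) * k₁ - 2 * (L - 3 * α) * (L - α) * k₂ +
        (L - 3 * α) * (L - 2 * α) * k₃
    rw [this]; positivity
  unfold StrictFeasible
  set r := conn α L with hrdef
  set p := pend α L with hpdef
  set q := (1 - α) ^ 2 / (L - 3 * α) with hqdef
  -- Strictness comes from the first row, where the contribution of `x₃` disappears.
  refine schur_lt_of_supersolution hr hr h₁ h₂ h₃ ?_ ?_ ?_ (Or.inl ?_)
  · nlinarith
  · rw [Nat.cast_sub ht]; push_cast; nlinarith
  · nlinarith
  · nlinarith

/-- Replacing `(A, C)` by `(A + p, C - p)` keeps the sum and, since `C ≥ A + 2 * p`, increases the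
product, so `1 / A + 1 / C` decreases. -/
theorem strictFeasible_move {s t k : ℕ} (hsk : k + 2 ≤ s) (hf : Feasible α L s t k) :
    StrictFeasible α L (s - 1) t (k + 1) := by
  obtain ⟨hA, hC, hB⟩ := hf
  have hr := h.conn_pos
  have hrp := h.conn_le_pend
  unfold StrictFeasible
  set r := conn α L with hrdef
  set p := pend α L with hpdef
  have hsk' : (k : ℝ) + 2 ≤ s := by exact_mod_cast hsk
  set A := L - s * p - α - r with hAd
  set C := L - k * p - α - r with hCd
  have hs : L - (s - 1 : ℕ) * p - α - r = A + p := by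
    rw [Nat.cast_sub (by omega)]; push_cast; ring
  have hk : L - (k + 1 : ℕ) * p - α - r = C - p := by push_cast; ring
  rw [hs, hk]
  have hp : 0 < p := by linarith
  have hAC : A + 2 * p ≤ C := by nlinarith
  have hCp : 0 < C - p := by linarith
  have hAp : 0 < A + p := by linarith
  refine ⟨hAp, hCp, lt_of_lt_of_le ?_ hB⟩
  rw [div_add_div _ _ hAp.ne' hCp.ne', div_add_div _ _ hA.ne' hC.ne',
    div_lt_div_iff₀ (by positivity) (by positivity)]
  have e : (A + p) * (C - p) - A * C = p * (C - A - p) := by ring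
  have e' : 0 < p * (C - A - p) := mul_pos hp (by linarith)
  have e'' : 0 < r ^ 2 * (A + C) := by positivity
  nlinarith

/-- If some degree exceeds `d + 1`, where `u = d`, the reduced end entry is larger than `pend`. -/
theorem pend_lt_of_feasible {s t k u : ℕ} (hf : Feasible α L s t k)
    (hu : u + 1 ≤ s ∨ u ≤ t ∨ u + 1 ≤ k) : pend α L < L - u * pend α L - α - conn α L := by
  obtain ⟨hA, hC, hB⟩ := hf
  have hr := h.conn_pos
  have hrp := h.conn_le_pend
  have hle := h.pend_sub_conn_le
  have hp : 0 < pend α L := by linarith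
  rcases hu with hu | hu | hu
  · have : (u : ℝ) + 1 ≤ s := by exact_mod_cast hu
    nlinarith
  · have : (u : ℝ) ≤ t := by exact_mod_cast hu
    have : 0 < conn α L ^ 2 / (L - s * pend α L - α - conn α L) := by positivity
    have : 0 < conn α L ^ 2 / (L - k * pend α L - α - conn α L) := by positivity
    nlinarith
  · have : (u : ℝ) + 1 ≤ k := by exact_mod_cast hu
    nlinarith

/-- Moving a pendant vertex from the middle centre to the end centre of smaller degree. -/
theorem strictFeasible_of_feasible_succ {u v : ℕ} (hv : u ≤ v + 2)
    (hf : Feasible α L (u + 1) (v + 1) u) : StrictFeasible α L (u + 1) v (u + 1) := by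
  obtain ⟨hA, hC, hB⟩ := hf
  have hr := h.conn_pos
  have hrp := h.conn_le_pend
  have hle := h.pend_sub_conn_le
  have hv' : (u : ℝ) ≤ v + 2 := by exact_mod_cast hv
  unfold StrictFeasible
  push_cast at *
  set r := conn α L with hrdef
  set p := pend α L with hpdef
  have hp : 0 < p := by linarith
  set E := L - (u + 1) * p - α - r with hE
  have e₁ : L - u * p - α - r = E + p := by rw [hE]; ring
  rw [e₁] at hB
  have hEp : 0 < E + p := by linarith
  refine ⟨hA, hA, ?_⟩
  have hpos : 0 < r ^ 2 / (E + p) := by positivity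
  have h1 : r ^ 2 < (L - (v + 1) * p - 2 * α - 2 * r) * E := by
    rw [← div_lt_iff₀ hA]; linarith
  have h2 : r ^ 2 < (E + p) * E := lt_of_lt_of_le h1
    (mul_le_mul_of_nonneg_right (by nlinarith) hA.le)
  -- The increase of the end term is less than the `p` gained in the middle, because `r ^ 2 < E * (E
  -- + p)`.
  have h3 : r ^ 2 / E - r ^ 2 / (E + p) < p := by
    rw [div_sub_div _ _ hA.ne' hEp.ne', div_lt_iff₀ (by positivity)]
    nlinarith
  linarith

/-- If some part is too large, the end entry of the target exceeds `pend` and its middle entry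
exceeds `2 * conn + α`, so the product beats `2 * conn ^ 2`. Otherwise the parts fall short of their
caps by one in total, and one pendant vertex moved from the middle to an end gives the target. -/
theorem strictFeasible_target_zero (hα : 1 / 2 ≤ α) {j s t k : ℕ} (hsum : s + t + k = 3 * j + 4)
    (hf : Feasible α L s t k) (hne : ¬ (s = j + 2 ∧ t = j ∧ k = j + 2)) :
    StrictFeasible α L (j + 2) j (j + 2) := by
  by_cases hbig : j + 2 + 1 ≤ s ∨ j + 2 ≤ t ∨ j + 2 + 1 ≤ k
  · have hE := h.pend_lt_of_feasible hf hbig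
    have hr := h.conn_pos
    have hrp := h.conn_le_pend
    have hge := h.pend_sub_conn_ge
    refine strictFeasible_of_mul_lt (by linarith) ?_
    have hB : 2 * conn α L + α < L - j * pend α L - 2 * α - 2 * conn α L := by
      push_cast at hE; linarith
    nlinarith
  · rcases (by omega : (s = j + 2 ∧ t = j + 1 ∧ k = j + 1) ∨ (s = j + 1 ∧ t = j + 1 ∧ k = j + 2))
      with ⟨rfl, rfl, rfl⟩ | ⟨rfl, rfl, rfl⟩
    · exact h.strictFeasible_of_feasible_succ (by omega) hf
    · exact h.strictFeasible_of_feasible_succ (by omega) hf.symm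

/-- Here the target attains all the caps, so every other distribution has an excessive part. The
entries then exceed `conn + 1 / 3` and `conn + 1 / 6`, whose product is larger than `2 * conn ^ 2`
because `conn < 1 - α ≤ 1 / 2`. -/
theorem strictFeasible_target_one (hα : 1 / 2 ≤ α) {j s t k : ℕ} (hsum : s + t + k = 3 * j + 5)
    (hf : Feasible α L s t k) (hne : ¬ (s = j + 2 ∧ t = j + 1 ∧ k = j + 2)) :
    StrictFeasible α L (j + 2) (j + 1) (j + 2) := by
  have hE := h.pend_lt_of_feasible (u := j + 2) hf (by omega)
  have hr := h.conn_pos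
  have hge := h.pend_sub_conn_ge
  have hlt := h.conn_lt
  refine strictFeasible_of_mul_lt (by linarith) ?_
  have hB : conn α L + 1 / 6 < L - (j + 1 : ℕ) * pend α L - 2 * α - 2 * conn α L := by
    push_cast at hE ⊢; linarith
  have hE' : conn α L + 1 / 3 < L - (j + 2 : ℕ) * pend α L - α - conn α L := by linarith
  nlinarith [mul_lt_mul'' hB hE' (by linarith) (by linarith)]

/-- Besides the moves from the middle to an end, the equal distribution `(j + 2, j + 2, j + 2)`
remains; balanced ends rule out everything else below the caps. -/
theorem strictFeasible_target_two (hα : 1 / 2 ≤ α) {j s t k : ℕ} (hsum : s + t + k = 3 * j + 6)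
    (hsk : s ≤ k + 1) (hks : k ≤ s + 1)
    (hf : Feasible α L s t k) (hne : ¬ (s = j + 3 ∧ t = j ∧ k = j + 3)) :
    StrictFeasible α L (j + 3) j (j + 3) := by
  have hr := h.conn_pos
  have hrp := h.conn_le_pend
  have hge := h.pend_sub_conn_ge
  have hle := h.pend_sub_conn_le
  by_cases hbig : j + 3 + 1 ≤ s ∨ j + 3 ≤ t ∨ j + 3 + 1 ≤ k
  · have hE := h.pend_lt_of_feasible hf hbig
    refine strictFeasible_of_mul_lt (by linarith) ?_
    have hB : 2 * conn α L + α < L - j * pend α L - 2 * α - 2 * conn α L := by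
      push_cast at hE; linarith
    nlinarith
  · rcases (by omega : (s = j + 3 ∧ t = j + 1 ∧ k = j + 2) ∨ (s = j + 2 ∧ t = j + 1 ∧ k = j + 3) ∨
      (s = j + 2 ∧ t = j + 2 ∧ k = j + 2))
      with ⟨rfl, rfl, rfl⟩ | ⟨rfl, rfl, rfl⟩ | ⟨rfl, rfl, rfl⟩
    · exact h.strictFeasible_of_feasible_succ (by omega) hf
    · exact h.strictFeasible_of_feasible_succ (by omega) hf.symm
    · obtain ⟨hA, -, hB⟩ := hf
      rw [← add_div, div_le_iff₀ hA] at hB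
      push_cast at hA hB
      set r := conn α L with hrdef
      set p := pend α L with hpdef
      set E := L - (j + 3) * p - α - r with hEd
      have e₁ : L - (j + 2) * p - α - r = E + p := by rw [hEd]; ring
      have e₂ : L - (j + 2) * p - 2 * α - 2 * r = E + p - α - r := by rw [hEd]; ring
      rw [e₁] at hA hB
      rw [e₂] at hB
      have hE2 : 0 < E + p - α - r := by
        refine pos_of_mul_pos_left (lt_of_lt_of_le ?_ hB) hA.le
        positivity
      refine strictFeasible_of_mul_lt ?_ ?_
      · push_cast; rw [← hrdef, ← hpdef, ← hEd]; linarith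
      · push_cast
        rw [← hrdef, ← hpdef, ← hEd,
          show L - j * p - 2 * α - 2 * r = E + 3 * p - α - r by rw [hEd]; ring]
        -- The new product of entries exceeds the old one by `p * (E - p + α + r)`, which is
        -- positive since `p - r ≤ α` and `E > 0`.
        nlinarith

end Large

end Reduced

/-! ### Local inequalities for a positive eigenvector. -/

section Perron

variable {V : Type*} [Fintype V] [DecidableEq V]

/-- `x` is a positive eigenvector of `A_α(G)` for the eigenvalue `L`. -/
structure IsPerron (α : ℝ) (G : SimpleGraph V) (L : ℝ) (x : V → ℝ) : Prop where
  pos : ∀ v, 0 < x v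
  mulVec_eq : ∀ v, (matrix α G *ᵥ x) v = L * x v

namespace IsPerron

variable {α L : ℝ} {G : SimpleGraph V} {x : V → ℝ}

theorem sum_le (hx : IsPerron α G L x) (h0 : 0 ≤ α) (h1 : α < 1) {v : V} {F : Finset V}
    (hF : ∀ w ∈ F, G.Adj v w) : ∑ w ∈ F, (α * x v + (1 - α) * x w) ≤ L * x v := by
  classical
  rw [← hx.mulVec_eq v, matrix_mulVec_apply]
  refine Finset.sum_le_sum_of_subset_of_nonneg (fun w hw => by simpa using hF w hw) ?_
  intro w _ _
  have := hx.pos v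
  have := hx.pos w
  have : 0 < 1 - α := by linarith
  positivity

theorem sum_lt (hx : IsPerron α G L x) (h0 : 0 ≤ α) (h1 : α < 1) {v u : V} {F : Finset V}
    (hF : ∀ w ∈ F, G.Adj v w) (hu : G.Adj v u) (huF : u ∉ F) :
    ∑ w ∈ F, (α * x v + (1 - α) * x w) < L * x v := by
  have h2 := hx.sum_le h0 h1 (v := v) (F := insert u F) (by
    intro w hw
    rcases Finset.mem_insert.1 hw with rfl | hw
    exacts [hu, hF w hw])
  rw [Finset.sum_insert huF] at h2
  have := hx.pos v
  have := hx.pos u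
  have : 0 < 1 - α := by linarith
  have : 0 < α * x v + (1 - α) * x u := by positivity
  linarith

/-- Each neighbour of `c` has value at least `(1 - α) * x c / (L - α)`. Three of them give `3 * pend
α L ≤ L`, the bound coming from a star with three leaves. -/
theorem large (hx : IsPerron α G L x) (h0 : 0 ≤ α) (h1 : α < 1) {c : V} {F : Finset V}
    (hF : ∀ w ∈ F, G.Adj c w) (hcard : 3 ≤ #F) : Large α L := by
  have hb : 0 < 1 - α := by linarith
  have hc := hx.pos c
  have hnb : ∀ w ∈ F, α * x w + (1 - α) * x c ≤ L * x w := by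
    intro w hw
    simpa using hx.sum_le h0 h1 (v := w) (F := {c}) (by simpa using (hF w hw).symm)
  have hLα : 0 < L - α := by
    obtain ⟨w, hw⟩ : F.Nonempty := Finset.card_pos.1 (by omega)
    have := hnb w hw
    have := hx.pos w
    by_contra hcon
    nlinarith [mul_pos hb hc]
  have hsum := hx.sum_le h0 h1 hF
  have hlow : #F * (α * x c + (1 - α) * ((1 - α) * x c / (L - α))) ≤
      ∑ w ∈ F, (α * x c + (1 - α) * x w) := by
    rw [← nsmul_eq_mul]
    refine Finset.card_nsmul_le_sum _ _ _ fun w hw => ?_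
    have : (1 - α) * x c / (L - α) ≤ x w := by
      rw [div_le_iff₀ hLα]; linarith [hnb w hw]
    nlinarith
  have h3 : (3 : ℝ) ≤ #F := by exact_mod_cast hcard
  have hq : 0 < (1 - α) ^ 2 / (L - α) := by positivity
  have e : α * x c + (1 - α) * ((1 - α) * x c / (L - α)) =
      (α + (1 - α) ^ 2 / (L - α)) * x c := by ring
  rw [e] at hlow
  have h4 : 3 * (α + (1 - α) ^ 2 / (L - α)) ≤ L := by
    refine le_of_mul_le_mul_right ?_ hc
    have : 0 ≤ (α + (1 - α) ^ 2 / (L - α)) * x c := by positivity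
    nlinarith
  refine ⟨h0, h1, by linarith, ?_⟩
  have h5 : 3 * ((1 - α) ^ 2 / (L - α)) ≤ L - 3 * α := by linarith
  have := mul_le_mul_of_nonneg_right h5 hLα.le
  rwa [mul_assoc, div_mul_cancel₀ _ hLα.ne'] at this

/-- Additional neighbours of `u` only raise its value, so a pendant vertex is the cheapest
neighbour. -/
theorem leaf_le (hx : IsPerron α G L x) (h : Large α L) {u c : V} (hu : G.Adj c u) :
    pend α L * x c ≤ α * x c + (1 - α) * x u := by
  have hb : 0 < 1 - α := by have := h.lt_one; linarith
  have h2 : α * x u + (1 - α) * x c ≤ L * x u := by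
    simpa using hx.sum_le h.nonneg h.lt_one (v := u) (F := {c}) (by simpa using hu.symm)
  have h3 : (1 - α) * x c / (L - α) ≤ x u := by
    rw [div_le_iff₀ h.sub_pos]; linarith
  have e : pend α L * x c = α * x c + (1 - α) * ((1 - α) * x c / (L - α)) := by
    unfold pend; ring
  rw [e]
  nlinarith

theorem conn_le (hx : IsPerron α G L x) (h : Large α L) {u c c' : V} (hc : G.Adj u c)
    (hc' : G.Adj u c') (hne : c ≠ c') : conn α L * (x c + x c') ≤ (1 - α) * x u := by
  have hb : 0 < 1 - α := by have := h.lt_one; linarith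
  have h2 := hx.sum_le h.nonneg h.lt_one (v := u) (F := {c, c'}) (by simp [hc, hc'])
  rw [Finset.sum_pair hne] at h2
  have h3 : (1 - α) * (x c + x c') / (L - 2 * α) ≤ x u := by
    rw [div_le_iff₀ h.sub_two_pos]; linarith
  have e : conn α L * (x c + x c') = (1 - α) * ((1 - α) * (x c + x c') / (L - 2 * α)) := by
    unfold conn; ring
  rw [e]
  nlinarith

theorem common_le (hx : IsPerron α G L x) (h : Large α L) {u c₁ c₂ c₃ : V} (h₁ : G.Adj u c₁)
    (h₂ : G.Adj u c₂) (h₃ : G.Adj u c₃) (h12 : c₁ ≠ c₂) (h13 : c₁ ≠ c₃) (h23 : c₂ ≠ c₃) :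
    (1 - α) ^ 2 / (L - 3 * α) * (x c₁ + x c₂ + x c₃) ≤ (1 - α) * x u := by
  have hb : 0 < 1 - α := by have := h.lt_one; linarith
  have h2 := hx.sum_le h.nonneg h.lt_one (v := u) (F := {c₁, c₂, c₃}) (by simp [h₁, h₂, h₃])
  rw [Finset.sum_insert (by simp [h12, h13]), Finset.sum_pair h23] at h2
  have h3 : (1 - α) * (x c₁ + x c₂ + x c₃) / (L - 3 * α) ≤ x u := by
    rw [div_le_iff₀ (by linarith [h.lt])]; linarith
  have e : (1 - α) ^ 2 / (L - 3 * α) * (x c₁ + x c₂ + x c₃) =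
      (1 - α) * ((1 - α) * (x c₁ + x c₂ + x c₃) / (L - 3 * α)) := by ring
  rw [e]
  nlinarith

theorem centre_le (hx : IsPerron α G L x) (h : Large α L) {c : V} {S E : Finset V}
    (hS : ∀ u ∈ S, G.Adj c u) (hE : ∀ u ∈ E, G.Adj c u) (hSE : Disjoint S E) :
    #S * (pend α L * x c) + ∑ w ∈ E, (α * x c + (1 - α) * x w) ≤ L * x c := by
  have h1 := hx.sum_le h.nonneg h.lt_one (v := c) (F := S ∪ E) (by
    intro w hw; rcases Finset.mem_union.1 hw with hw | hw; exacts [hS w hw, hE w hw])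
  rw [Finset.sum_union hSE] at h1
  have := Finset.card_nsmul_le_sum S (fun w => α * x c + (1 - α) * x w) (pend α L * x c)
    fun u hu => hx.leaf_le h (hS u hu)
  rw [nsmul_eq_mul] at this
  linarith

theorem centre_lt (hx : IsPerron α G L x) (h : Large α L) {c u : V} {S E : Finset V}
    (hS : ∀ u ∈ S, G.Adj c u) (hE : ∀ u ∈ E, G.Adj c u) (hSE : Disjoint S E)
    (hu : G.Adj c u) (huS : u ∉ S) (huE : u ∉ E) :
    #S * (pend α L * x c) + ∑ w ∈ E, (α * x c + (1 - α) * x w) < L * x c := by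
  have h1 := hx.sum_lt h.nonneg h.lt_one (v := c) (F := S ∪ E) (by
    intro w hw; rcases Finset.mem_union.1 hw with hw | hw; exacts [hS w hw, hE w hw]) hu
    (by simp [huS, huE])
  rw [Finset.sum_union hSE] at h1
  have := Finset.card_nsmul_le_sum S (fun w => α * x c + (1 - α) * x w) (pend α L * x c)
    fun u hu => hx.leaf_le h (hS u hu)
  rw [nsmul_eq_mul] at this
  linarith

end IsPerron

end Perron

/-! ### Structure around the three centres outside a maximum independent set. -/

section Centres

variable {V : Type*}

/-- The vertices outside the independent set `I` are the three distinct vertices `c₁`, `c₂`, `c₃`,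
and `f` chooses a neighbour of every vertex of `I`. -/
structure Centres (G : SimpleGraph V) (I : Finset V) (f : V → V) (c₁ c₂ c₃ : V) : Prop where
  indep : ∀ u ∈ I, ∀ v ∈ I, ¬ G.Adj u v
  cover : ∀ v, v ∈ I ∨ v = c₁ ∨ v = c₂ ∨ v = c₃
  notMem₁ : c₁ ∉ I
  notMem₂ : c₂ ∉ I
  notMem₃ : c₃ ∉ I
  ne12 : c₁ ≠ c₂
  ne13 : c₁ ≠ c₃
  ne23 : c₂ ≠ c₃
  adj : ∀ u ∈ I, G.Adj u (f u)

/-- Two centres are adjacent or have a common neighbour in `I`. -/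
def Linked (G : SimpleGraph V) (I : Finset V) (c c' : V) : Prop :=
  G.Adj c c' ∨ ∃ u ∈ I, G.Adj u c ∧ G.Adj u c'

theorem Linked.symm {G : SimpleGraph V} {I : Finset V} {c c' : V} (h : Linked G I c c') :
    Linked G I c' c :=
  h.imp (fun h => h.symm) fun ⟨u, hu, h₁, h₂⟩ => ⟨u, hu, h₂, h₁⟩

/-- The vertices of `I` outside `W` assigned to the centre `c`. -/
def pendants [DecidableEq V] (I W : Finset V) (f : V → V) (c : V) : Finset V := (I \ W).filter fun u => f u = c

namespace Centres

variable {G : SimpleGraph V} {I : Finset V} {f : V → V} {c₁ c₂ c₃ : V}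

theorem swap₁₃ (h : Centres G I f c₁ c₂ c₃) : Centres G I f c₃ c₂ c₁ where
  indep := h.indep
  cover v := by rcases h.cover v with h | h | h | h <;> tauto
  notMem₁ := h.notMem₃
  notMem₂ := h.notMem₂
  notMem₃ := h.notMem₁
  ne12 := h.ne23.symm
  ne13 := h.ne13.symm
  ne23 := h.ne12.symm
  adj := h.adj

theorem swap₁₂ (h : Centres G I f c₁ c₂ c₃) : Centres G I f c₂ c₁ c₃ where
  indep := h.indep
  cover v := by rcases h.cover v with h | h | h | h <;> tauto
  notMem₁ := h.notMem₂
  notMem₂ := h.notMem₁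
  notMem₃ := h.notMem₃
  ne12 := h.ne12.symm
  ne13 := h.ne23
  ne23 := h.ne13
  adj := h.adj

/-- Otherwise `c₁` together with its neighbours in `I` would be closed under adjacency, against
connectedness. -/
theorem linked (h : Centres G I f c₁ c₂ c₃) (hG : G.Connected) :
    Linked G I c₁ c₂ ∨ Linked G I c₁ c₃ := by
  by_contra hcon
  rw [not_or] at hcon
  obtain ⟨h12, h13⟩ := hcon
  have : c₂ ∈ {v | v = c₁ ∨ (v ∈ I ∧ G.Adj v c₁)} := by
    refine hG.mem_of_closed (a := c₁) (Or.inl rfl) ?_ c₂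
    rintro v w (rfl | ⟨hv, hvc⟩) hvw
    · rcases h.cover w with hw | rfl | rfl | rfl
      · exact Or.inr ⟨hw, hvw.symm⟩
      · exact Or.inl rfl
      · exact absurd (Or.inl hvw) h12
      · exact absurd (Or.inl hvw) h13
    · rcases h.cover w with hw | rfl | rfl | rfl
      · exact absurd hvw (h.indep v hv w hw)
      · exact Or.inl rfl
      · exact absurd (Or.inr ⟨v, hv, hvc, hvw⟩) h12
      · exact absurd (Or.inr ⟨v, hv, hvc, hvw⟩) h13
  rcases this with h' | h'
  · exact h.ne12 h'.symm
  · exact h.notMem₂ h'.1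

theorem exists_linked (h : Centres G I f c₁ c₂ c₃) (hG : G.Connected) :
    ∃ d₁ d₂ d₃, Centres G I f d₁ d₂ d₃ ∧ Linked G I d₁ d₂ ∧ Linked G I d₂ d₃ := by
  rcases h.linked hG with h12 | h13
  · rcases h.swap₁₃.linked hG with h32 | h31
    · exact ⟨_, _, _, h, h12, h32.symm⟩
    · exact ⟨_, _, _, h.swap₁₂, h12.symm, h31.symm⟩
  · rcases h.swap₁₂.linked hG with h21 | h23
    · exact ⟨_, _, _, h.swap₁₂, h21, h13⟩
    · exact ⟨_, _, _, h.swap₁₃.swap₁₂.swap₁₃, h13, h23.symm⟩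

variable [DecidableEq V]

theorem card_pendants (h : Centres G I f c₁ c₂ c₃) {W : Finset V} (hW : W ⊆ I) :
    #(pendants I W f c₁) + #(pendants I W f c₂) + #(pendants I W f c₃) + #W = #I := by
  have hmaps : ∀ u ∈ I \ W, f u ∈ ({c₁, c₂, c₃} : Finset V) := by
    intro u hu
    have huI := (Finset.mem_sdiff.1 hu).1
    rcases h.cover (f u) with h' | h' | h' | h'
    · exact absurd (h.adj u huI) (h.indep u huI _ h')
    all_goals simp [h']
  have := Finset.card_eq_sum_card_fiberwise hmaps
  rw [Finset.sum_insert (by simp [h.ne12, h.ne13]), Finset.sum_pair h.ne23,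
    Finset.card_sdiff_of_subset hW] at this
  have := Finset.card_le_card hW
  unfold pendants
  omega

theorem adj_of_mem_pendants (h : Centres G I f c₁ c₂ c₃) {W : Finset V} {c u : V}
    (hu : u ∈ pendants I W f c) : G.Adj c u := by
  simp only [pendants, Finset.mem_filter, Finset.mem_sdiff] at hu
  obtain ⟨⟨huI, -⟩, rfl⟩ := hu
  exact (h.adj u huI).symm

theorem mem_of_mem_pendants {W : Finset V} {c u : V} (hu : u ∈ pendants I W f c) :
    u ∈ I ∧ u ∉ W ∧ f u = c := by
  simp only [pendants, Finset.mem_filter, Finset.mem_sdiff] at hu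
  tauto

/-- If all degrees of centres were at most two, six vertices of `I` would give each centre exactly
two assigned neighbours, and the link between `c₁` and `c₂` supplies a third to one of them. -/
theorem exists_three_adj (h : Centres G I f c₁ c₂ c₃) (hI : 6 ≤ #I) (h12 : Linked G I c₁ c₂) :
    ∃ (c : V) (F : Finset V), (∀ w ∈ F, G.Adj c w) ∧ 3 ≤ #F := by
  by_contra! hcon
  have hcard := h.card_pendants (W := ∅) (by simp)
  rw [Finset.card_empty] at hcard
  have l : ∀ c, #(pendants I ∅ f c) < 3 := fun c => hcon c _ fun w hw => h.adj_of_mem_pendants hw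
  have l₁ := l c₁
  have l₂ := l c₂
  have l₃ := l c₃
  have key : ∀ c u, G.Adj c u → u ∉ pendants I ∅ f c → 2 ≤ #(pendants I ∅ f c) → False := by
    intro c u hcu hu h2
    have := hcon c (insert u (pendants I ∅ f c)) (by
      intro w hw
      rcases Finset.mem_insert.1 hw with rfl | hw
      exacts [hcu, h.adj_of_mem_pendants hw])
    rw [Finset.card_insert_of_notMem hu] at this
    omega
  rcases h12 with hadj | ⟨u, -, hu1, hu2⟩
  · exact key c₁ c₂ hadj (fun hm => h.notMem₂ (mem_of_mem_pendants hm).1) (by omega)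
  · by_cases hf : f u = c₁
    · exact key c₂ u hu2.symm (fun hm => h.ne12 (hf.symm.trans (mem_of_mem_pendants hm).2.2))
        (by omega)
    · exact key c₁ u hu1.symm (fun hm => hf (mem_of_mem_pendants hm).2.2) (by omega)

/-- A graph whose edges are exactly those of the tree spanned by the centres, two vertices of degree
two and the pendant vertices is isomorphic to some `H3 s t k`. -/
theorem nonempty_iso (h : Centres G I f c₁ c₂ c₃) {w₁ w₂ : V} (hw₁ : w₁ ∈ I) (hw₂ : w₂ ∈ I)
    (hne : w₁ ≠ w₂) (a11 : G.Adj w₁ c₁) (a12 : G.Adj w₁ c₂) (a22 : G.Adj w₂ c₂)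
    (a23 : G.Adj w₂ c₃)
    (n₁ : ∀ v, G.Adj c₁ v → v ∈ pendants I {w₁, w₂} f c₁ ∨ v = w₁)
    (n₂ : ∀ v, G.Adj c₂ v → v ∈ pendants I {w₁, w₂} f c₂ ∨ v = w₁ ∨ v = w₂)
    (n₃ : ∀ v, G.Adj c₃ v → v ∈ pendants I {w₁, w₂} f c₃ ∨ v = w₂) :
    Nonempty (G ≃g H3 #(pendants I {w₁, w₂} f c₁) #(pendants I {w₁, w₂} f c₂)
      #(pendants I {w₁, w₂} f c₃)) := by
  have hm : ∀ c u, u ∈ pendants I {w₁, w₂} f c ↔ u ∈ I ∧ u ≠ w₁ ∧ u ≠ w₂ ∧ f u = c := by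
    intro c u
    simp only [pendants, Finset.mem_filter, Finset.mem_sdiff, Finset.mem_insert,
      Finset.mem_singleton, not_or]
    tauto
  have hfc : ∀ u ∈ I, f u = c₁ ∨ f u = c₂ ∨ f u = c₃ := by
    intro u hu
    exact (h.cover (f u)).resolve_left fun h' => h.indep u hu _ h' (h.adj u hu)
  have m₁ : ∀ v, G.Adj c₁ v ↔ (v ∈ I ∧ v ≠ w₁ ∧ v ≠ w₂ ∧ f v = c₁) ∨ v = w₁ := by
    intro v
    rw [← hm]
    exact ⟨n₁ v, by rintro (h' | rfl); exacts [h.adj_of_mem_pendants h', a11.symm]⟩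
  have m₂ : ∀ v, G.Adj c₂ v ↔ (v ∈ I ∧ v ≠ w₁ ∧ v ≠ w₂ ∧ f v = c₂) ∨ v = w₁ ∨ v = w₂ := by
    intro v
    rw [← hm]
    exact ⟨n₂ v, by rintro (h' | rfl | rfl); exacts [h.adj_of_mem_pendants h', a12.symm, a22.symm]⟩
  have m₃ : ∀ v, G.Adj c₃ v ↔ (v ∈ I ∧ v ≠ w₁ ∧ v ≠ w₂ ∧ f v = c₃) ∨ v = w₂ := by
    intro v
    rw [← hm]
    exact ⟨n₃ v, by rintro (h' | rfl); exacts [h.adj_of_mem_pendants h', a23.symm]⟩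
  have hindep := h.indep
  have hn1 := h.notMem₁
  have hn2 := h.notMem₂
  have hn3 := h.notMem₃
  have h12 := h.ne12
  have h13 := h.ne13
  have h23 := h.ne23
  have k₁ : ∀ c (i : Fin #(pendants I {w₁, w₂} f c)),
      ((pendants I {w₁, w₂} f c).equivFin.symm i : V) ∈ I ∧
      ((pendants I {w₁, w₂} f c).equivFin.symm i : V) ≠ w₁ ∧
      ((pendants I {w₁, w₂} f c).equivFin.symm i : V) ≠ w₂ ∧
      f ((pendants I {w₁, w₂} f c).equivFin.symm i : V) = c := fun c i =>
    (hm c _).1 (Subtype.prop _)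
  have kinj : ∀ c (i j : Fin #(pendants I {w₁, w₂} f c)),
      ((pendants I {w₁, w₂} f c).equivFin.symm i : V) =
      ((pendants I {w₁, w₂} f c).equivFin.symm j : V) → i = j := fun c i j hij =>
    (pendants I {w₁, w₂} f c).equivFin.symm.injective (Subtype.ext hij)
  have ksurj : ∀ c u, u ∈ I → u ≠ w₁ → u ≠ w₂ → f u = c →
      ∃ i, ((pendants I {w₁, w₂} f c).equivFin.symm i : V) = u := fun c u h1 h2 h3 h4 =>
    ⟨(pendants I {w₁, w₂} f c).equivFin ⟨u, (hm c u).2 ⟨h1, h2, h3, h4⟩⟩, by simp⟩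
  -- The enumerations are abstracted so that the three cardinalities can become variables.
  generalize hg₁ : (fun i => ((pendants I {w₁, w₂} f c₁).equivFin.symm i : V)) = g₁
  generalize hg₂ : (fun i => ((pendants I {w₁, w₂} f c₂).equivFin.symm i : V)) = g₂
  generalize hg₃ : (fun i => ((pendants I {w₁, w₂} f c₃).equivFin.symm i : V)) = g₃
  have p₁ : ∀ i, g₁ i ∈ I ∧ g₁ i ≠ w₁ ∧ g₁ i ≠ w₂ ∧ f (g₁ i) = c₁ := by
    intro i; rw [← hg₁]; exact k₁ c₁ i
  have p₂ : ∀ i, g₂ i ∈ I ∧ g₂ i ≠ w₁ ∧ g₂ i ≠ w₂ ∧ f (g₂ i) = c₂ := by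
    intro i; rw [← hg₂]; exact k₁ c₂ i
  have p₃ : ∀ i, g₃ i ∈ I ∧ g₃ i ≠ w₁ ∧ g₃ i ≠ w₂ ∧ f (g₃ i) = c₃ := by
    intro i; rw [← hg₃]; exact k₁ c₃ i
  have i₁ : ∀ i j, g₁ i = g₁ j → i = j := by rw [← hg₁]; exact kinj c₁
  have i₂ : ∀ i j, g₂ i = g₂ j → i = j := by rw [← hg₂]; exact kinj c₂
  have i₃ : ∀ i j, g₃ i = g₃ j → i = j := by rw [← hg₃]; exact kinj c₃
  have s₁ : ∀ u, u ∈ I → u ≠ w₁ → u ≠ w₂ → f u = c₁ → ∃ i, g₁ i = u := by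
    rw [← hg₁]; exact ksurj c₁
  have s₂ : ∀ u, u ∈ I → u ≠ w₁ → u ≠ w₂ → f u = c₂ → ∃ i, g₂ i = u := by
    rw [← hg₂]; exact ksurj c₂
  have s₃ : ∀ u, u ∈ I → u ≠ w₁ → u ≠ w₂ → f u = c₃ → ∃ i, g₃ i = u := by
    rw [← hg₃]; exact ksurj c₃
  clear hg₁ hg₂ hg₃ k₁ kinj ksurj
  revert g₁ g₂ g₃
  generalize #(pendants I {w₁, w₂} f c₁) = s
  generalize #(pendants I {w₁, w₂} f c₂) = t
  generalize #(pendants I {w₁, w₂} f c₃) = k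
  intro g₁ g₂ g₃ p₁ p₂ p₃ i₁ i₂ i₃ s₁ s₂ s₃
  let φ : H3Vertex s t k → V :=
    Sum.elim ![c₁, w₁, c₂, w₂, c₃] (Sum.elim g₁ (Sum.elim g₂ g₃))
  have hinj : Function.Injective φ := by
    rintro (a | a | a | a) (b | b | b | b) hab <;> simp only [φ, Sum.elim_inl, Sum.elim_inr] at hab
    · fin_cases a <;> fin_cases b <;> simp at hab ⊢ <;> grind
    all_goals first
      | (fin_cases a <;> simp at hab <;> grind)
      | (fin_cases b <;> simp at hab <;> grind)
      | grind
  have hsurj : Function.Surjective φ := by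
    intro v
    rcases h.cover v with hv | rfl | rfl | rfl
    · by_cases hv1 : v = w₁
      · exact ⟨.inl 1, by simp [φ, hv1]⟩
      by_cases hv2 : v = w₂
      · exact ⟨.inl 3, by simp [φ, hv2]⟩
      rcases hfc v hv with hf | hf | hf
      · obtain ⟨i, hi⟩ := s₁ v hv hv1 hv2 hf
        exact ⟨.inr (.inl i), by simp [φ, hi]⟩
      · obtain ⟨i, hi⟩ := s₂ v hv hv1 hv2 hf
        exact ⟨.inr (.inr (.inl i)), by simp [φ, hi]⟩
      · obtain ⟨i, hi⟩ := s₃ v hv hv1 hv2 hf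
        exact ⟨.inr (.inr (.inr i)), by simp [φ, hi]⟩
    · exact ⟨.inl 0, by simp [φ]⟩
    · exact ⟨.inl 2, by simp [φ]⟩
    · exact ⟨.inl 4, by simp [φ]⟩
  have hcI : ∀ a : Fin 5, ∀ u ∈ I, u ≠ w₁ → u ≠ w₂ → (G.Adj (φ (.inl a)) u ↔
      (a = 0 ∧ f u = c₁) ∨ (a = 2 ∧ f u = c₂) ∨ (a = 4 ∧ f u = c₃)) := by
    intro a u hu h1 h2
    fin_cases a <;> simp [φ, m₁, m₂, m₃, hu, h1, h2, hindep _ hw₁ _ hu, hindep _ hw₂ _ hu]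
  have hIφ : ∀ b, φ (.inr b) ∈ I := by
    rintro (b | b | b)
    exacts [(p₁ b).1, (p₂ b).1, (p₃ b).1]
  have hadj : ∀ a b, G.Adj (φ a) (φ b) ↔ (H3 s t k).Adj a b := by
    have hlr : ∀ (a : Fin 5) b, G.Adj (φ (.inl a)) (φ (.inr b)) ↔
        (H3 s t k).Adj (.inl a) (.inr b) := by
      rintro a (b | b | b)
      · obtain ⟨q, q', q'', q'''⟩ := p₁ b
        rw [show φ (.inr (.inl b)) = g₁ b from rfl, hcI a _ q q' q'', H3_adj_inl_s, q''']
        simp [h12, h13]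
      · obtain ⟨q, q', q'', q'''⟩ := p₂ b
        rw [show φ (.inr (.inr (.inl b))) = g₂ b from rfl, hcI a _ q q' q'', H3_adj_inl_t, q''']
        simp [h12.symm, h23]
      · obtain ⟨q, q', q'', q'''⟩ := p₃ b
        rw [show φ (.inr (.inr (.inr b))) = g₃ b from rfl, hcI a _ q q' q'', H3_adj_inl_k, q''']
        simp [h13.symm, h23.symm]
    rintro (a | a) (b | b)
    · rw [H3_adj_inl_inl]
      have z₁ : w₁ ≠ c₁ := fun e => hn1 (e ▸ hw₁)
      have z₂ : w₁ ≠ c₂ := fun e => hn2 (e ▸ hw₁)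
      have z₃ : w₁ ≠ c₃ := fun e => hn3 (e ▸ hw₁)
      have z₄ : w₂ ≠ c₁ := fun e => hn1 (e ▸ hw₂)
      have z₅ : w₂ ≠ c₂ := fun e => hn2 (e ▸ hw₂)
      have z₆ : w₂ ≠ c₃ := fun e => hn3 (e ▸ hw₂)
      have y₁ : ∀ v, G.Adj v c₁ ↔ G.Adj c₁ v := fun v => G.adj_comm v c₁
      have y₂ : ∀ v, G.Adj v c₂ ↔ G.Adj c₂ v := fun v => G.adj_comm v c₂
      have y₃ : ∀ v, G.Adj v c₃ ↔ G.Adj c₃ v := fun v => G.adj_comm v c₃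
      have u₁ := hindep _ hw₁ _ hw₂
      have u₂ := hindep _ hw₂ _ hw₁
      fin_cases a <;> fin_cases b <;>
        simp [φ, m₁, m₂, m₃, y₁, y₂, y₃, hn1, hn2, hn3, hne, hne.symm, u₁, u₂, z₁.symm,
          z₂.symm, z₃.symm, z₄.symm, z₅.symm, z₆.symm]
    · exact hlr a b
    · rw [G.adj_comm, (H3 s t k).adj_comm]; exact hlr b a
    · exact iff_of_false (hindep _ (hIφ a) _ (hIφ b)) (H3_adj_inr_inr a b)
  exact ⟨(⟨Equiv.ofBijective φ ⟨hinj, hsurj⟩, fun {a b} => hadj a b⟩ : H3 s t k ≃g G).symm⟩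

variable [Fintype V] {α L : ℝ} {x : V → ℝ}

/-- All of `I` is pendant here; each of the two subdivisions uses up one pendant vertex, so the
order is preserved. -/
theorem exists_strictFeasible_of_edge_edge (h : Centres G I f c₁ c₂ c₃) (hx : IsPerron α G L x)
    (hL : Large α L) (hI : 6 ≤ #I) (h12 : G.Adj c₁ c₂) (h23 : G.Adj c₂ c₃) :
    ∃ s t k, s + t + k + 2 = #I ∧ StrictFeasible α L s t k := by
  have hcard := h.card_pendants (W := ∅) (by simp)
  have hb : 0 < 1 - α := by have := hL.lt_one; linarith
  have e₁ := hx.centre_le hL (c := c₁) (S := pendants I ∅ f c₁) (E := {c₂})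
    (fun u hu => h.adj_of_mem_pendants hu) (by simpa using h12)
    (by simpa using fun hm => h.notMem₂ (mem_of_mem_pendants hm).1)
  have e₂ := hx.centre_le hL (c := c₂) (S := pendants I ∅ f c₂) (E := {c₁, c₃})
    (fun u hu => h.adj_of_mem_pendants hu) (by simp [h12.symm, h23])
    (by
      simp only [Finset.disjoint_insert_right, Finset.disjoint_singleton_right]
      exact ⟨fun hm => h.notMem₁ (mem_of_mem_pendants hm).1,
        fun hm => h.notMem₃ (mem_of_mem_pendants hm).1⟩)
  have e₃ := hx.centre_le hL (c := c₃) (S := pendants I ∅ f c₃) (E := {c₂})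
    (fun u hu => h.adj_of_mem_pendants hu) (by simpa using h23.symm)
    (by simpa using fun hm => h.notMem₂ (mem_of_mem_pendants hm).1)
  rw [Finset.sum_singleton] at e₁ e₃
  rw [Finset.sum_pair h.ne13] at e₂
  obtain ⟨hA, hC, hB⟩ := schur_of_supersolution
    (A := L - #(pendants I ∅ f c₁) * pend α L - α)
    (B := L - #(pendants I ∅ f c₂) * pend α L - 2 * α)
    (C := L - #(pendants I ∅ f c₃) * pend α L - α) hb hb (hx.pos c₁) (hx.pos c₂) (hx.pos c₃)
    (by linarith) (by linarith) (by linarith)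
  rw [Finset.card_empty] at hcard
  obtain ⟨s, t, k, hs, hf⟩ := hL.exists_strictFeasible_of_edge_edge (by omega) hA hC hB
  exact ⟨s, t, k, by omega, hf⟩

theorem exists_strictFeasible_of_edge_path (h : Centres G I f c₁ c₂ c₃) (hx : IsPerron α G L x)
    (hL : Large α L) (hI : 6 ≤ #I) (h12 : G.Adj c₁ c₂) {w : V} (hw : w ∈ I) (hw2 : G.Adj w c₂)
    (hw3 : G.Adj w c₃) :
    ∃ s t k, s + t + k + 2 = #I ∧ StrictFeasible α L s t k := by
  have hcard := h.card_pendants (W := {w}) (by simpa using hw)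
  have hb : 0 < 1 - α := by have := hL.lt_one; linarith
  have e₁ := hx.centre_le hL (c := c₁) (S := pendants I {w} f c₁) (E := {c₂})
    (fun u hu => h.adj_of_mem_pendants hu) (by simpa using h12)
    (by simpa using fun hm => h.notMem₂ (mem_of_mem_pendants hm).1)
  have e₂ := hx.centre_le hL (c := c₂) (S := pendants I {w} f c₂) (E := {c₁, w})
    (fun u hu => h.adj_of_mem_pendants hu) (by simp [h12.symm, hw2.symm])
    (by
      simp only [Finset.disjoint_insert_right, Finset.disjoint_singleton_right]
      exact ⟨fun hm => h.notMem₁ (mem_of_mem_pendants hm).1,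
        fun hm => (mem_of_mem_pendants hm).2.1 (by simp)⟩)
  have e₃ := hx.centre_le hL (c := c₃) (S := pendants I {w} f c₃) (E := {w})
    (fun u hu => h.adj_of_mem_pendants hu) (by simpa using hw3.symm)
    (by simpa using fun hm => (mem_of_mem_pendants hm).2.1 (by simp))
  rw [Finset.sum_singleton] at e₁ e₃
  rw [Finset.sum_pair (show c₁ ≠ w from fun he => h.notMem₁ (he ▸ hw))] at e₂
  have ew := hx.conn_le hL hw2 hw3 h.ne23
  have hf : EdgePathFeasible α L #(pendants I {w} f c₁) #(pendants I {w} f c₂)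
      #(pendants I {w} f c₃) :=
    schur_of_supersolution hb hL.conn_pos (hx.pos c₁) (hx.pos c₂) (hx.pos c₃)
      (by linarith) (by linarith) (by linarith)
  rw [Finset.card_singleton] at hcard
  obtain ⟨s, t, k, hs, hf⟩ := hL.exists_strictFeasible_of_edgePath (by omega) hf
  exact ⟨s, t, k, by omega, hf⟩

theorem exists_strictFeasible_of_common (h : Centres G I f c₁ c₂ c₃) (hx : IsPerron α G L x)
    (hL : Large α L) (hI : 6 ≤ #I) {w : V} (hw : w ∈ I) (hw1 : G.Adj w c₁) (hw2 : G.Adj w c₂)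
    (hw3 : G.Adj w c₃) :
    ∃ s t k, s + t + k + 2 = #I ∧ StrictFeasible α L s t k := by
  have hcard := h.card_pendants (W := {w}) (by simpa using hw)
  have ew := hx.common_le hL hw1 hw2 hw3 h.ne12 h.ne13 h.ne23
  have e : ∀ c, G.Adj w c → (1 - α) ^ 2 / (L - 3 * α) * (x c₁ + x c₂ + x c₃) ≤
      (L - #(pendants I {w} f c) * pend α L - α) * x c := by
    intro c hc
    have := hx.centre_le hL (c := c) (S := pendants I {w} f c) (E := {w})
      (fun u hu => h.adj_of_mem_pendants hu) (by simpa using hc.symm)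
      (by simpa using fun hm => (mem_of_mem_pendants hm).2.1 (by simp))
    rw [Finset.sum_singleton] at this
    linarith
  have e₁ := e c₁ hw1
  have e₂ := e c₂ hw2
  have e₃ := e c₃ hw3
  have p₁ := hx.pos c₁
  have p₂ := hx.pos c₂
  have p₃ := hx.pos c₃
  rw [Finset.card_singleton] at hcard
  -- The configuration is symmetric in the centres, so one that has a pendant vertex can be taken as
  -- the middle one.
  rcases (by omega : 1 ≤ #(pendants I {w} f c₂) ∨ 1 ≤ #(pendants I {w} f c₁) ∨
    1 ≤ #(pendants I {w} f c₃)) with h' | h' | h'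
  · exact ⟨_, _, _, by omega,
      hL.strictFeasible_of_common_neighbor h' p₁ p₂ p₃ e₁ e₂ e₃⟩
  · rw [add_comm (x c₁)] at e₁ e₂ e₃
    exact ⟨_, _, _, by omega,
      hL.strictFeasible_of_common_neighbor h' p₂ p₁ p₃ e₂ e₁ e₃⟩
  · rw [add_right_comm] at e₁ e₂ e₃
    exact ⟨_, _, _, by omega,
      hL.strictFeasible_of_common_neighbor h' p₁ p₃ p₂ e₁ e₃ e₂⟩

/-- An edge outside the spanning tree ends at some centre and makes its row strict; without such an
edge, `G` is the tree itself. -/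
theorem strictFeasible_or_iso (h : Centres G I f c₁ c₂ c₃) (hx : IsPerron α G L x)
    (hL : Large α L) {w₁ w₂ : V} (hw₁ : w₁ ∈ I) (hw₂ : w₂ ∈ I)
    (hne : w₁ ≠ w₂) (a11 : G.Adj w₁ c₁) (a12 : G.Adj w₁ c₂) (a22 : G.Adj w₂ c₂)
    (a23 : G.Adj w₂ c₃) :
    ∃ s t k, s + t + k + 2 = #I ∧ (StrictFeasible α L s t k ∨
      (Feasible α L s t k ∧ Nonempty (G ≃g H3 s t k))) := by
  have hcard := h.card_pendants (W := {w₁, w₂}) (by simp [Finset.insert_subset_iff, hw₁, hw₂])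
  rw [Finset.card_pair hne] at hcard
  refine ⟨_, _, _, hcard, ?_⟩
  set W : Finset V := {w₁, w₂} with hW
  have hd : ∀ c, ∀ w ∈ W, w ∉ pendants I W f c := fun c w hw hm => (mem_of_mem_pendants hm).2.1 hw
  have d₁ : ∀ c, Disjoint (pendants I W f c) {w₁} := fun c => by
    simpa using hd c w₁ (by simp [hW])
  have d₂ : ∀ c, Disjoint (pendants I W f c) {w₂} := fun c => by
    simpa using hd c w₂ (by simp [hW])
  have d : ∀ c, Disjoint (pendants I W f c) {w₁, w₂} := fun c =>
    Finset.disjoint_right.2 (hd c)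
  have hS : ∀ c, ∀ u ∈ pendants I W f c, G.Adj c u := fun c u hu => h.adj_of_mem_pendants hu
  have b₁ : ∀ u ∈ ({w₁} : Finset V), G.Adj c₁ u := by simpa using a11.symm
  have b₂ : ∀ u ∈ ({w₁, w₂} : Finset V), G.Adj c₂ u := by simp [a12.symm, a22.symm]
  have b₃ : ∀ u ∈ ({w₂} : Finset V), G.Adj c₃ u := by simpa using a23.symm
  have e₁ := hx.centre_le hL (hS c₁) b₁ (d₁ c₁)
  have e₂ := hx.centre_le hL (hS c₂) b₂ (d c₂)
  have e₃ := hx.centre_le hL (hS c₃) b₃ (d₂ c₃)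
  have k₁ := hx.conn_le hL a11 a12 h.ne12
  have k₂ := hx.conn_le hL a22 a23 h.ne23
  rw [Finset.sum_singleton] at e₁ e₃
  rw [Finset.sum_pair hne] at e₂
  have hr := hL.conn_pos
  by_cases n₁ : ∀ v, G.Adj c₁ v → v ∈ pendants I W f c₁ ∨ v = w₁
  swap
  · push Not at n₁
    obtain ⟨v, hv, hv', hv''⟩ := n₁
    have l := hx.centre_lt hL (hS c₁) b₁ (d₁ c₁) hv hv' (by simpa using hv'')
    rw [Finset.sum_singleton] at l
    exact Or.inl (schur_lt_of_supersolution hr hr (hx.pos c₁) (hx.pos c₂) (hx.pos c₃)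
      (by linarith) (by linarith) (by linarith) (Or.inl (by linarith)))
  by_cases n₂ : ∀ v, G.Adj c₂ v → v ∈ pendants I W f c₂ ∨ v = w₁ ∨ v = w₂
  swap
  · push Not at n₂
    obtain ⟨v, hv, hv', hv''⟩ := n₂
    have l := hx.centre_lt hL (hS c₂) b₂ (d c₂) hv hv' (by simpa using hv'')
    rw [Finset.sum_pair hne] at l
    exact Or.inl (schur_lt_of_supersolution hr hr (hx.pos c₁) (hx.pos c₂) (hx.pos c₃)
      (by linarith) (by linarith) (by linarith) (Or.inr (Or.inl (by linarith))))
  by_cases n₃ : ∀ v, G.Adj c₃ v → v ∈ pendants I W f c₃ ∨ v = w₂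
  swap
  · push Not at n₃
    obtain ⟨v, hv, hv', hv''⟩ := n₃
    have l := hx.centre_lt hL (hS c₃) b₃ (d₂ c₃) hv hv' (by simpa using hv'')
    rw [Finset.sum_singleton] at l
    exact Or.inl (schur_lt_of_supersolution hr hr (hx.pos c₁) (hx.pos c₂) (hx.pos c₃)
      (by linarith) (by linarith) (by linarith) (Or.inr (Or.inr (by linarith))))
  exact Or.inr ⟨schur_of_supersolution hr hr (hx.pos c₁) (hx.pos c₂) (hx.pos c₃)
      (by linarith) (by linarith) (by linarith),
    h.nonempty_iso hw₁ hw₂ hne a11 a12 a22 a23 n₁ n₂ n₃⟩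

theorem exists_strictFeasible_or_iso (h : Centres G I f c₁ c₂ c₃) (hx : IsPerron α G L x)
    (hL : Large α L) (hI : 6 ≤ #I) (h12 : Linked G I c₁ c₂) (h23 : Linked G I c₂ c₃) :
    ∃ s t k, s + t + k + 2 = #I ∧ (StrictFeasible α L s t k ∨
      (Feasible α L s t k ∧ Nonempty (G ≃g H3 s t k))) := by
  have wrap : (∃ s t k, s + t + k + 2 = #I ∧ StrictFeasible α L s t k) →
      ∃ s t k, s + t + k + 2 = #I ∧ (StrictFeasible α L s t k ∨
        (Feasible α L s t k ∧ Nonempty (G ≃g H3 s t k))) :=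
    fun ⟨s, t, k, hs, hf⟩ => ⟨s, t, k, hs, Or.inl hf⟩
  rcases h12 with h12 | ⟨w₁, hw₁, a11, a12⟩ <;> rcases h23 with h23 | ⟨w₂, hw₂, a22, a23⟩
  · exact wrap (h.exists_strictFeasible_of_edge_edge hx hL hI h12 h23)
  · exact wrap (h.exists_strictFeasible_of_edge_path hx hL hI h12 hw₂ a22 a23)
  · exact wrap (h.swap₁₃.exists_strictFeasible_of_edge_path hx hL hI h23.symm hw₁ a12 a11)
  · by_cases hne : w₁ = w₂
    · subst hne
      exact wrap (h.exists_strictFeasible_of_common hx hL hI hw₁ a11 a12 a23)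
    · exact h.strictFeasible_or_iso hx hL hw₁ hw₂ hne a11 a12 a22 a23

end Centres

variable [Fintype V] [DecidableEq V]

theorem exists_centres {n : ℕ} (hn : 3 ≤ n) {G : SimpleGraph V} (hG : InClass n (n - 3) G) :
    ∃ (I : Finset V) (f : V → V) (c₁ c₂ c₃ : V), #I = n - 3 ∧ Centres G I f c₁ c₂ c₃ := by
  obtain ⟨hcard, hconn, hind⟩ := hG
  obtain ⟨I, hI⟩ := G.exists_isNIndepSet_indepNum
  have hIc : #I = n - 3 := by rw [hI.2, hind]
  have h3 : #Iᶜ = 3 := by rw [Finset.card_compl, hcard, hIc]; omega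
  obtain ⟨c₁, c₂, c₃, h12, h13, h23, hC⟩ := Finset.card_eq_three.1 h3
  have hmem : ∀ v, v ∉ I ↔ v = c₁ ∨ v = c₂ ∨ v = c₃ := by
    intro v; rw [← Finset.mem_compl, hC]; simp
  have : Nontrivial V := ⟨c₁, c₂, h12⟩
  have hex : ∀ u : V, ∃ v, G.Adj u v := fun u => hconn.preconnected.exists_adj_of_nontrivial u
  choose f hf using hex
  refine ⟨I, f, c₁, c₂, c₃, hIc, ?_, ?_, ?_, ?_, ?_, h12, h13, h23, fun u _ => hf u⟩
  · exact fun u hu v hv huv => hI.1 (Finset.mem_coe.2 hu) (Finset.mem_coe.2 hv) huv.ne huv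
  · intro v
    by_cases hv : v ∈ I
    · exact Or.inl hv
    · exact Or.inr ((hmem v).1 hv)
  · exact (hmem c₁).2 (by simp)
  · exact (hmem c₂).2 (by simp)
  · exact (hmem c₃).2 (by simp)

/-- A minimizer is isomorphic to some `H3 s t k` feasible at its index, and no `H3 s t k` of the same
order is feasible with slack. -/
theorem IsMinimizer.exists_iso {α : ℝ} (h0 : 0 ≤ α) (h1 : α < 1) {n : ℕ} (hn : 9 ≤ n)
    {G : SimpleGraph V} (hG : IsMinimizer α n (n - 3) G) :
    Large α (index α G) ∧
      (∀ s t k, s + t + k = n - 5 → ¬ StrictFeasible α (index α G) s t k) ∧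
      ∃ s t k, s + t + k = n - 5 ∧ Feasible α (index α G) s t k ∧ Nonempty (G ≃g H3 s t k) := by
  obtain ⟨I, f, c₁, c₂, c₃, hI, hC⟩ := exists_centres (by omega) hG.1
  obtain ⟨d₁, d₂, d₃, hD, h12, h23⟩ := hC.exists_linked hG.1.2.1
  obtain ⟨x, hpos, hx⟩ := exists_perron h0 h1 hG.1.2.1
  have hP : IsPerron α G (index α G) x := ⟨hpos, hx⟩
  obtain ⟨c, F, hF, hF3⟩ := hD.exists_three_adj (by omega) h12
  have hL := hP.large h0 h1 hF hF3
  have hno : ∀ s t k, s + t + k = n - 5 → ¬ StrictFeasible α (index α G) s t k :=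
    fun s t k hs hf => (hL.index_H3_lt hf).not_ge (hG.index_le_H3 (by omega) hs)
  refine ⟨hL, hno, ?_⟩
  obtain ⟨s, t, k, hs, hf | hf⟩ := hD.exists_strictFeasible_or_iso hP hL (by omega) h12 h23
  · exact absurd hf (hno s t k (by omega))
  · exact ⟨s, t, k, by omega, hf⟩

end Centres

end AAlpha

/-! ### Conclusion: balanced ends and the extremal shapes. -/

theorem theorem1p3 {V : Type*} [Fintype V] [DecidableEq V] (n : ℕ) (hn : 9 ≤ n)
    (α : ℝ) (hα0 : 0 ≤ α) (hα1 : α < 1)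
    (G : SimpleGraph V) (hG : AAlpha.IsMinimizer α n (n - 3) G) :
    (∃ s t k : ℕ, |(s : ℤ) - (k : ℤ)| ≤ 1 ∧ s + t + k = n - 5 ∧
        Nonempty (G ≃g AAlpha.H3 s t k)) ∧
      (∀ m : ℕ, 1 / 2 ≤ α → n = 3 * m →
        Nonempty (G ≃g AAlpha.H3 (m - 1) (m - 3) (m - 1))) ∧
      (∀ m : ℕ, 1 / 2 ≤ α → n = 3 * m + 1 →
        Nonempty (G ≃g AAlpha.H3 (m - 1) (m - 2) (m - 1))) ∧
      (∀ m : ℕ, 11 / 20 ≤ α → n = 3 * m + 2 →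
        Nonempty (G ≃g AAlpha.H3 m (m - 3) m)) := by
  obtain ⟨hL, hno, s, t, k, hs, hf, hiso⟩ := hG.exists_iso hα0 hα1 hn
  have hsk : s ≤ k + 1 := by
    by_contra! hcon
    exact hno _ _ _ (by omega) (hL.strictFeasible_move (by omega) hf)
  have hks : k ≤ s + 1 := by
    by_contra! hcon
    exact hno _ _ _ (by omega) (hL.strictFeasible_move (by omega) hf.symm)
  refine ⟨⟨s, t, k, by rw [abs_le]; omega, hs, hiso⟩, ?_, ?_, ?_⟩
  · intro m hα hm
    -- From `n ≥ 9` one gets `m ≥ 3`, so no subtraction in the parameters is truncated.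
    obtain ⟨j, rfl⟩ : ∃ j, m = j + 3 := ⟨m - 3, by omega⟩
    by_cases hne : s = j + 2 ∧ t = j ∧ k = j + 2
    · obtain ⟨rfl, rfl, rfl⟩ := hne
      exact hiso
    · exact absurd (hL.strictFeasible_target_zero hα (by omega) hf hne) (hno _ _ _ (by omega))
  · intro m hα hm
    obtain ⟨j, rfl⟩ : ∃ j, m = j + 3 := ⟨m - 3, by omega⟩
    by_cases hne : s = j + 2 ∧ t = j + 1 ∧ k = j + 2
    · obtain ⟨rfl, rfl, rfl⟩ := hne
      exact hiso
    · exact absurd (hL.strictFeasible_target_one hα (by omega) hf hne) (hno _ _ _ (by omega))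
  · intro m hα hm
    obtain ⟨j, rfl⟩ : ∃ j, m = j + 3 := ⟨m - 3, by omega⟩
    by_cases hne : s = j + 3 ∧ t = j ∧ k = j + 3
    · obtain ⟨rfl, rfl, rfl⟩ := hne
      exact hiso
    · exact absurd (hL.strictFeasible_target_two (by linarith) (by omega) hsk hks hf hne)
        (hno _ _ _ (by omega))
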